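/- Work in ZFC with classes. Throughout, embeddings $j\colon V\to M$ are elementary embeddings of the universe into a transitive class. For a cardinal $\kappa$ and an ordinal $\theta$, a *$\theta$-strongness embedding for $\kappa$* is such an embedding $j\colon V\to M$ with critical point $\kappa$ and $V_\theta\subseteq M$; $\kappa$ is *$\theta$-strong* if one exists. A function $\ell\colon\kappa\to V_\kappa$ is a *$\theta$-strongness Laver function* for $\kappa$ if for every $a\in V_\theta$ there is a $\theta$-strongness embedding $j$ for $\kappa$ with $j(\ell)(\kappa)=a$. A *$\theta$-strongness joint Laver sequence for $\kappa$ of length $\lambda$* is a sequence $\langle \ell_\alpha;\alpha<\lambda\rangle$ of $\theta$-strongness Laver functions for $\kappa$ such that for every sequence $\langle a_\alpha;\alpha<\lambda\rangle$ of elements of $V_\theta$ there is a single $\theta$-strongness embedding $j$ for $\kappa$ with $j(\ell_\alpha)(\kappa)=a_\alpha$ for all $\alpha<\lambda$. For a limit ordinal $\theta>\kappa$, a *$(\kappa,V_\theta)$-extender* is a system of measures on $V_\kappa$ of the form $E=\{(a,X) : a\in V_\theta,\ X\subseteq V_\kappa,\ a\in j(X)\}$ derived from some $\theta$-strongness embedding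 $j$ for $\kappa$ with $V_\theta\subseteq j(V_\kappa)$. The *$\theta$-strongness Mitchell order* for $\kappa$ is the relation on $(\kappa,V_\theta)$-extenders given by $E\triangleleft F$ iff $E$ is an element of the transitive collapse of the ultrapower of $V$ by $F$. When $\triangleleft$ is well-founded, the *$\theta$-strongness Mitchell rank* of $\kappa$ is its height, $\sup\{\operatorname{rank}_{\triangleleft}(E)+1 : E \text{ a } (\kappa,V_\theta)\text{-extender}\}$; the largest possible value of this rank is $\beth_\theta^+$. **Theorem.** Let $\kappa$ be a $\theta$-strong cardinal, where $\theta$ is a limit ordinal and $\operatorname{cf}(\theta)\leq\kappa<\theta$. If there is a $\theta$-strongness joint Laver sequence for $\kappa$ of length $\operatorname{cf}(\theta)$, then $\kappa$ has maximal $\theta$-strongness Mitchell rank: the order $\triangleleft$ is well-founded and the $\theta$-strongness Mitchell rank of $\kappa$ equals $\beth_\theta^+$. -/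

import Mathlib

universe u

open scoped ZFSet Cardinal

noncomputable section

namespace StrongLaver

/-- The only symbol of the language of set theory: a binary relation symbol. -/
inductive SetRel : ℕ → Type
  | mem : SetRel 2

/-- The first-order language of set theory. -/
def setLanguage : FirstOrder.Language.{0, 0} := ⟨fun _ => Empty, SetRel⟩

/-- The universe `V` as a structure: the symbol is interpreted by true membership. -/
instance universeStructure : setLanguage.Structure ZFSet.{u} where
  funMap := fun f => nomatch f
  RelMap := fun r x => match r with
    | SetRel.mem => x 0 ∈ x 1

/-- A class `M` of sets as a structure with true membership. -/
instance classStructure (M : Set ZFSet.{u}) : setLanguage.Structure M where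
  funMap := fun f => nomatch f
  RelMap := fun r x => match r with
    | SetRel.mem => (x 0 : ZFSet.{u}) ∈ (x 1 : ZFSet.{u})

/-- A `θ`-strongness embedding for `κ`: a fully elementary embedding `j : V → M` into a transitive
class `M` with critical point `κ` and `V_θ ⊆ M`. (The class `M` is then an inner model: it satisfies
ZFC, being elementarily equivalent to `V`, and it contains every ordinal `α`, since `α ≤ j α`.) -/
structure StrongnessEmbedding (κ : Cardinal.{u}) (θ : Ordinal.{u}) where
  /-- The target model. -/
  M : Set ZFSet.{u}
  transitive : ∀ x ∈ M, ∀ y ∈ x, y ∈ M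
  /-- The elementary embedding. -/
  j : setLanguage.ElementaryEmbedding ZFSet.{u} M
  fixes_below : ∀ α : Ordinal.{u}, α < κ.ord → (j α.toZFSet : ZFSet.{u}) = α.toZFSet
  moves : (j κ.ord.toZFSet : ZFSet.{u}) ≠ κ.ord.toZFSet
  vonNeumann_subset : ∀ x ∈ V_ θ, x ∈ M

/-- `κ` is `θ`-strong. -/
def IsStrong (κ : Cardinal.{u}) (θ : Ordinal.{u}) : Prop :=
  Nonempty (StrongnessEmbedding κ θ)

/-- `ℓ` guesses the target `a` via `j`: the function `j(ℓ)` takes the value `a` at `κ`. -/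
def Guesses {κ : Cardinal.{u}} {θ : Ordinal.{u}} (e : StrongnessEmbedding κ θ)
    (ℓ a : ZFSet.{u}) : Prop :=
  ZFSet.pair κ.ord.toZFSet a ∈ (e.j ℓ : ZFSet.{u})

/-- `ℓ : κ → V_κ` is a `θ`-strongness Laver function for `κ`. -/
def IsLaverFunction (κ : Cardinal.{u}) (θ : Ordinal.{u}) (ℓ : ZFSet.{u}) : Prop :=
  ZFSet.IsFunc κ.ord.toZFSet (V_ κ.ord) ℓ ∧
    ∀ a ∈ V_ θ, ∃ e : StrongnessEmbedding κ θ, Guesses e ℓ a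

/-- `⟨ℓ α ; α < lam⟩` is a `θ`-strongness joint Laver sequence for `κ`. Only the values of `ℓ` and
of the sequence of targets `a` at ordinals `α < lam` matter. -/
def IsJointLaverSequence (κ : Cardinal.{u}) (θ lam : Ordinal.{u})
    (ℓ : Ordinal.{u} → ZFSet.{u}) : Prop :=
  (∀ α < lam, IsLaverFunction κ θ (ℓ α)) ∧
    ∀ a : Ordinal.{u} → ZFSet.{u}, (∀ α < lam, a α ∈ V_ θ) →
      ∃ e : StrongnessEmbedding κ θ, ∀ α < lam, Guesses e (ℓ α) (a α)

/-- The system of measures derived from `j` with seeds in `V_θ`, coded as a set of pairs: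
`(a, X)` belongs to it iff `a ∈ V_θ`, `X ⊆ V_κ` and `a ∈ j(X)`, so that its section at `a` is the
measure on `V_κ` derived from the seed `a`. -/
def derivedExtender {κ : Cardinal.{u}} {θ : Ordinal.{u}} (e : StrongnessEmbedding κ θ) :
    ZFSet.{u} :=
  ZFSet.sep (fun z => ∃ a X : ZFSet.{u}, z = ZFSet.pair a X ∧ a ∈ (e.j X : ZFSet.{u}))
    (ZFSet.prod (V_ θ) (ZFSet.powerset (V_ κ.ord)))

/-- `E` is a `(κ, V_θ)`-extender (`θ` a limit ordinal above `κ`): it is derived from a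
`θ`-strongness embedding `j` with `V_θ ⊆ j(V_κ)`. The last clause says that the measure derived
from each seed in `V_θ` does concentrate on `V_κ`. -/
def IsExtender (κ : Cardinal.{u}) (θ : Ordinal.{u}) (E : ZFSet.{u}) : Prop :=
  ∃ e : StrongnessEmbedding κ θ,
    V_ θ ⊆ (e.j (V_ κ.ord) : ZFSet.{u}) ∧ E = derivedExtender e

/-- The relation induced by `R` on representatives `(a, f)`, `(b, g)` of elements of the ultrapower
of `V` by the extender `F`: the set of pairs `(x, y) ∈ V_κ` with `R (f x) (g y)` belongs to the
measure of `F` with seed `(a, b)`. For limit `θ`, all finite sequences of seeds are coded in `V_θ`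
by iterated pairs, so seeds that are single elements of `V_θ` suffice. Only the restrictions of
`f` and `g` to `V_κ` matter. -/
def UltRel (κ : Cardinal.{u}) (F : ZFSet.{u}) (R : ZFSet.{u} → ZFSet.{u} → Prop)
    (a : ZFSet.{u}) (f : ZFSet.{u} → ZFSet.{u}) (b : ZFSet.{u}) (g : ZFSet.{u} → ZFSet.{u}) :
    Prop :=
  ZFSet.pair (ZFSet.pair a b)
    (ZFSet.sep (fun z => ∃ x y : ZFSet.{u}, z = ZFSet.pair x y ∧ R (f x) (g y)) (V_ κ.ord)) ∈ F

/-- `N` is the transitive collapse of the ultrapower of `V` by `F`, where `π a f` is the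
element of `N` represented by the seed `a ∈ V_θ` and the function `f` on `V_κ`. -/
structure IsCollapsedUltrapower (κ : Cardinal.{u}) (θ : Ordinal.{u}) (F : ZFSet.{u})
    (N : Set ZFSet.{u}) (π : ZFSet.{u} → (ZFSet.{u} → ZFSet.{u}) → ZFSet.{u}) : Prop where
  transitive : ∀ x ∈ N, ∀ y ∈ x, y ∈ N
  range_eq : ∀ x, x ∈ N ↔ ∃ a ∈ V_ θ, ∃ f : ZFSet.{u} → ZFSet.{u}, π a f = x
  eq_iff : ∀ a ∈ V_ θ, ∀ b ∈ V_ θ, ∀ f g : ZFSet.{u} → ZFSet.{u},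
    π a f = π b g ↔ UltRel κ F (· = ·) a f b g
  mem_iff : ∀ a ∈ V_ θ, ∀ b ∈ V_ θ, ∀ f g : ZFSet.{u} → ZFSet.{u},
    π a f ∈ π b g ↔ UltRel κ F (· ∈ ·) a f b g

/-- The `θ`-strongness Mitchell order `E ◁ F` on the `(κ, V_θ)`-extenders: `E` is an element of
the transitive collapse of the ultrapower of `V` by `F`. -/
def MitchellOrder (κ : Cardinal.{u}) (θ : Ordinal.{u})
    (E F : {E : ZFSet.{u} // IsExtender κ θ E}) : Prop :=
  ∃ N π, IsCollapsedUltrapower κ θ F.1 N π ∧ E.1 ∈ N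

/-- The `θ`-strongness Mitchell rank of `κ`: the height of the (well-founded) `θ`-strongness
Mitchell order, that is, the supremum of `rank E + 1` over all `(κ, V_θ)`-extenders `E`. -/
def mitchellRank (κ : Cardinal.{u}) (θ : Ordinal.{u})
    [IsWellFounded _ (MitchellOrder κ θ)] : Ordinal.{u + 1} :=
  ⨆ E : {E : ZFSet.{u} // IsExtender κ θ E},
    Order.succ (IsWellFounded.rank (MitchellOrder κ θ) E)

/-- The Mitchell order is well-founded and its height is the largest possible one, `ℶ_θ⁺`. -/
def HasMaximalMitchellRank (κ : Cardinal.{u}) (θ : Ordinal.{u}) : Prop :=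
  ∃ _ : IsWellFounded _ (MitchellOrder κ θ),
    mitchellRank κ θ = Ordinal.lift.{u + 1} (Order.succ (ℶ_ θ)).ord

end StrongLaver

end

/-!
To an extender `E` with embedding `j` one attaches the height of `j (wfSum V_κ)`, where `wfSum K`
is the disjoint sum, with a top point above each summand, of all well-founded relations on `K`.
If `E` lies in the ultrapower `M` of `V` by `F`, then `E` codes its own relation `j_E (wfSum V_κ)`
by a well-founded relation on codes in `V_θ ⊆ j_F (V_κ)`, and this code belongs to `M`. By
elementarity it is one of the summands of `j_F (wfSum V_κ)`, so the height drops strictly. Hence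
the Mitchell order is well-founded, and no ultrapower has to be computed inside another one.

An extender has at most `ℶ_θ` predecessors, because each of them is represented by an element of
the ultrapower that is coded in `V_θ`; this bounds every rank below `ℶ_θ⁺`. Conversely, let `τ` be
cofinal in `θ`. For `A ⊆ V_θ` the joint Laver sequence guesses the pieces of `A` below `V_(τ α)`
simultaneously, so `A` belongs to the target of the embedding. Coding `ℶ_θ` many extenders into one
`A` yields an extender above all of them, so the ranks exhaust `ℶ_θ⁺`.
-/

noncomputable section

namespace StrongLaver

open FirstOrder FirstOrder.Language

/-- A class of sets is transitive if it contains the elements of its elements. This is a type class,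
so that transitivity of the target of an embedding is found by instance resolution. -/
class IsTransitiveClass (M : Set ZFSet.{u}) : Prop where
  mem_of_mem : ∀ x ∈ M, ∀ y ∈ x, y ∈ M

instance : IsTransitiveClass (Set.univ : Set ZFSet.{u}) := ⟨fun _ _ _ _ => trivial⟩

instance {κ : Cardinal.{u}} {θ : Ordinal.{u}} (e : StrongnessEmbedding κ θ) :
    IsTransitiveClass e.M :=
  ⟨e.transitive⟩

/-- A predicate on assignments of sets to variables is *absolute* if a single formula expresses it
in every transitive class. -/
class Absolute {α : Type} (P : (α → ZFSet.{u}) → Prop) : Prop where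
  exists_formula : ∃ φ : setLanguage.Formula α, ∀ (M : Set ZFSet.{u}) [IsTransitiveClass M],
    ∀ v : α → M, φ.Realize v ↔ P fun i => v i

namespace Absolute

variable {α : Type} {P Q : (α → ZFSet.{u}) → Prop}

theorem congr (hP : Absolute P) (h : ∀ v, P v ↔ Q v) : Absolute Q := by
  rwa [← funext fun v => propext (h v)]

theorem comp {β : Type} (hP : Absolute P) (s : α → β) :
    Absolute fun v : β → ZFSet.{u} => P fun i => v (s i) := by
  obtain ⟨φ, hφ⟩ := hP
  refine ⟨φ.relabel s, fun M _ v => ?_⟩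
  rw [Formula.realize_relabel]
  exact hφ M _

instance mem (i k : α) : Absolute fun v : α → ZFSet.{u} => v i ∈ v k := by
  let memSymbol : setLanguage.Relations 2 := SetRel.mem
  refine ⟨memSymbol.formula₂ (Term.var i) (Term.var k), fun M _ v => ?_⟩
  rw [Formula.realize_rel₂]
  rfl

instance eq (i k : α) : Absolute fun v : α → ZFSet.{u} => v i = v k := by
  refine ⟨Term.equal (Term.var i) (Term.var k), fun M _ v => ?_⟩
  rw [Formula.realize_equal]
  exact Subtype.ext_iff

instance not [hP : Absolute P] : Absolute fun v => ¬ P v := by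
  obtain ⟨φ, hφ⟩ := hP
  refine ⟨φ.not, fun M _ v => ?_⟩
  rw [Formula.realize_not, hφ]

instance imp [hP : Absolute P] [hQ : Absolute Q] : Absolute fun v => P v → Q v := by
  obtain ⟨φ, hφ⟩ := hP
  obtain ⟨ψ, hψ⟩ := hQ
  refine ⟨φ.imp ψ, fun M _ v => ?_⟩
  rw [Formula.realize_imp, hφ, hψ]

instance and [Absolute P] [Absolute Q] : Absolute fun v => P v ∧ Q v :=
  congr (P := fun v => ¬ (P v → ¬ Q v)) inferInstance fun v => by tauto

instance or [Absolute P] [Absolute Q] : Absolute fun v => P v ∨ Q v :=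
  congr (P := fun v => ¬ P v → Q v) inferInstance fun v => by tauto

instance iff [Absolute P] [Absolute Q] : Absolute fun v => P v ↔ Q v :=
  congr (P := fun v => (P v → Q v) ∧ (Q v → P v)) inferInstance fun v => by tauto

instance forall_finite {ι : Type} [Finite ι] {P : ι → (α → ZFSet.{u}) → Prop}
    [hP : ∀ i, Absolute (P i)] : Absolute fun v => ∀ i, P i v := by
  choose φ hφ using fun i => (hP i).exists_formula
  refine ⟨Formula.iInf φ, fun M _ v => ?_⟩
  rw [Formula.realize_iInf]
  exact forall_congr' fun i => hφ i M v

instance bex (i : α) {R : (α → ZFSet.{u}) → ZFSet.{u} → Prop}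
    [hR : Absolute fun v : Option α → ZFSet.{u} => R (fun k => v (some k)) (v none)] :
    Absolute fun v => ∃ x ∈ v i, R v x := by
  have h : Absolute fun v : Option α → ZFSet.{u} =>
      v none ∈ v (some i) ∧ R (fun k => v (some k)) (v none) := inferInstance
  obtain ⟨φ, hφ⟩ := h
  refine ⟨(φ.relabel fun k : Option α => k.elim (Sum.inr ()) Sum.inl).iExs Unit,
    fun M _ v => ?_⟩
  simp only [Formula.realize_iExs, Formula.realize_relabel, hφ]
  constructor
  · rintro ⟨x, hx, hR⟩
    exact ⟨x (), hx, hR⟩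
  · rintro ⟨x, hx, hR⟩
    exact ⟨fun _ => ⟨x, IsTransitiveClass.mem_of_mem _ (v i).2 x hx⟩, hx, hR⟩

instance ball (i : α) {R : (α → ZFSet.{u}) → ZFSet.{u} → Prop}
    [Absolute fun v : Option α → ZFSet.{u} => R (fun k => v (some k)) (v none)] :
    Absolute fun v => ∀ x ∈ v i, R v x :=
  congr (P := fun v => ¬ ∃ x ∈ v i, ¬ R v x) inferInstance fun v => by push Not; rfl

instance subset (i k : α) : Absolute fun v : α → ZFSet.{u} => v i ⊆ v k :=
  inferInstanceAs (Absolute fun v : α → ZFSet.{u} => ∀ x ∈ v i, x ∈ v k)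

instance eq_empty (i : α) : Absolute fun v : α → ZFSet.{u} => v i = ∅ :=
  congr (P := fun v => ∀ x ∈ v i, x ∉ v i) inferInstance fun v => by
    rw [ZFSet.eq_empty]
    exact ⟨fun h x hx => h x hx hx, fun h x hx => absurd hx (h x)⟩

instance eq_insert_self (i k : α) :
    Absolute fun v : α → ZFSet.{u} => v i = insert (v k) (v k) :=
  congr (P := fun v => v k ∈ v i ∧ v k ⊆ v i ∧ ∀ x ∈ v i, x = v k ∨ x ∈ v k) inferInstance
    fun v => by
      refine ⟨fun ⟨hmem, hsub, h⟩ => ZFSet.ext fun x => ?_, fun h => ?_⟩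
      · rw [ZFSet.mem_insert_iff]
        exact ⟨h x, fun hx => hx.elim (fun hx => hx ▸ hmem) (@hsub x)⟩
      · simp only [h, ZFSet.mem_insert_iff, ZFSet.subset_def]
        tauto

instance eq_doubleton (i a b : α) : Absolute fun v : α → ZFSet.{u} => v i = {v a, v b} :=
  congr (P := fun v => v a ∈ v i ∧ v b ∈ v i ∧ ∀ x ∈ v i, x = v a ∨ x = v b) inferInstance
    fun v => by
      refine ⟨fun ⟨ha, hb, h⟩ => ZFSet.ext fun x => ?_, fun h => ?_⟩
      · rw [ZFSet.mem_pair]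
        exact ⟨h x, fun hx => hx.elim (fun hx => hx ▸ ha) (fun hx => hx ▸ hb)⟩
      · simp only [h, ZFSet.mem_pair]
        tauto

instance eq_pair (i a b : α) : Absolute fun v : α → ZFSet.{u} => v i = ZFSet.pair (v a) (v b) :=
  congr (P := fun v => ∃ s ∈ v i, ∃ t ∈ v i, s = {v a, v a} ∧ t = {v a, v b} ∧ v i = {s, t})
    inferInstance fun v => by
      rw [ZFSet.pair]
      constructor
      · rintro ⟨_, -, _, -, rfl, rfl, h⟩
        rwa [ZFSet.pair_eq_singleton] at h
      · intro h
        refine ⟨_, ?_, _, ?_, rfl, rfl, ?_⟩ <;> simp [h]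

instance pair_mem (a b i : α) : Absolute fun v : α → ZFSet.{u} => ZFSet.pair (v a) (v b) ∈ v i :=
  congr (P := fun v => ∃ z ∈ v i, z = ZFSet.pair (v a) (v b)) inferInstance fun v => by simp

instance ex_pair (i : α) {R : (α → ZFSet.{u}) → ZFSet.{u} → ZFSet.{u} → Prop}
    [Absolute fun v : Option (Option (Option (Option α))) → ZFSet.{u} =>
      R (fun k => v (some (some (some (some k))))) (v (some (some none))) (v none)] :
    Absolute fun v => ∃ x y, v i = ZFSet.pair x y ∧ R v x y :=
  congr (P := fun v => ∃ s ∈ v i, ∃ x ∈ s, ∃ t ∈ v i, ∃ y ∈ t, v i = ZFSet.pair x y ∧ R v x y)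
    inferInstance fun v => by
      constructor
      · rintro ⟨s, -, x, -, t, -, y, -, h⟩
        exact ⟨x, y, h⟩
      · rintro ⟨x, y, h, h'⟩
        exact ⟨{x}, by simp [h, ZFSet.pair], x, by simp, {x, y}, by simp [h, ZFSet.pair], y,
          by simp, h, h'⟩

instance is_pair (i : α) : Absolute fun v : α → ZFSet.{u} => ∃ x y, v i = ZFSet.pair x y :=
  congr (P := fun v => ∃ x y, v i = ZFSet.pair x y ∧ x = x) inferInstance fun v => by simp

instance ex_pair_mem (i k : α) {R : (α → ZFSet.{u}) → ZFSet.{u} → Prop}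
    [Absolute fun v : Option (Option (Option (Option (Option α)))) → ZFSet.{u} =>
      R (fun l => v (some (some (some (some (some l)))))) (v none)] :
    Absolute fun v => ∃ y, ZFSet.pair (v i) y ∈ v k ∧ R v y :=
  congr (P := fun v => ∃ z ∈ v k, ∃ x y, z = ZFSet.pair x y ∧ (x = v i ∧ R v y)) inferInstance
    fun v => by
      constructor
      · rintro ⟨_, hz, _, y, rfl, rfl, hR⟩
        exact ⟨y, hz, hR⟩
      · rintro ⟨y, hy, hR⟩
        exact ⟨_, hy, _, y, rfl, rfl, hR⟩

instance ex_pair_mem_left (i k : α) :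
    Absolute fun v : α → ZFSet.{u} => ∃ y, ZFSet.pair (v i) y ∈ v k :=
  congr (P := fun v => ∃ y, ZFSet.pair (v i) y ∈ v k ∧ y = y) inferInstance fun v => by simp

end Absolute

section Transfer

variable {M N : Set ZFSet.{u}} [IsTransitiveClass M] [IsTransitiveClass N]
  (j : setLanguage.ElementaryEmbedding ZFSet.{u} M) (k : setLanguage.ElementaryEmbedding N M)

/-- The universe, regarded as the class of all sets. -/
def univEquiv : setLanguage.Equiv ZFSet.{u} (Set.univ : Set ZFSet.{u}) where
  toEquiv := (Equiv.Set.univ ZFSet.{u}).symm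
  map_fun' f := nomatch f
  map_rel' {n} (r : SetRel n) x := match n, r, x with
    | _, SetRel.mem, _ => Iff.rfl

theorem Absolute.map_iff_of_class {α : Type} (P : (α → ZFSet.{u}) → Prop) [hP : Absolute P]
    (v : α → N) : P (fun i => k (v i)) ↔ P fun i => v i := by
  obtain ⟨φ, hφ⟩ := hP
  exact (hφ M (k ∘ v)).symm.trans ((k.map_formula φ v).trans (hφ N v))

theorem mem_iff_of_class {x y : N} :
    (k x : ZFSet.{u}) ∈ (k y : ZFSet.{u}) ↔ (x : ZFSet.{u}) ∈ (y : ZFSet.{u}) :=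
  Absolute.map_iff_of_class k (fun v : Fin 2 → ZFSet.{u} => v 0 ∈ v 1) ![x, y]

theorem Absolute.map_iff {α : Type} (P : (α → ZFSet.{u}) → Prop) [Absolute P]
    (v : α → ZFSet.{u}) : P (fun i => j (v i)) ↔ P v :=
  map_iff_of_class (j.comp univEquiv.symm.toElementaryEmbedding) P fun i => univEquiv (v i)

theorem Absolute.realize_iff {α : Type} {P : (α → ZFSet.{u}) → Prop} {φ : setLanguage.Formula α}
    (hφ : ∀ (M : Set ZFSet.{u}) [IsTransitiveClass M], ∀ v : α → M,
      φ.Realize v ↔ P fun i => v i) (v : α → ZFSet.{u}) : φ.Realize v ↔ P v := by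
  rw [← univEquiv.toElementaryEmbedding.map_formula]
  exact hφ Set.univ _

/-- Transfer of a universal statement whose matrix `P v → φ` is not required to be absolute. -/
theorem realize_of_forall {α β : Type} [Finite β] (φ : setLanguage.Formula (α ⊕ β))
    (P : (α ⊕ β → ZFSet.{u}) → Prop) [hP : Absolute P] (s : α → ZFSet.{u})
    (h : ∀ x : β → ZFSet.{u}, P (Sum.elim s x) → φ.Realize (Sum.elim s x)) (x : β → M)
    (hx : P fun i => (Sum.elim (fun i => j (s i)) x i : M)) :
    φ.Realize (Sum.elim (fun i => j (s i)) x) := by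
  obtain ⟨ψ, hψ⟩ := hP
  have hV : ((ψ.imp φ).iAlls β).Realize s := by
    rw [Formula.realize_iAlls]
    intro x
    rw [Formula.realize_imp, Absolute.realize_iff hψ]
    exact h x
  have hM := (j.map_formula _ s).2 hV
  rw [Formula.realize_iAlls] at hM
  exact Formula.realize_imp.1 (hM x) ((hψ M _).2 hx)

theorem Absolute.of_forall {α β : Type} [Finite β] (P : (α ⊕ β → ZFSet.{u}) → Prop)
    [hP : Absolute P] (s : α → ZFSet.{u}) (h : ∀ x : β → ZFSet.{u}, P (Sum.elim s x))
    (x : β → M) : P fun i => (Sum.elim (fun i => j (s i)) x i : M) := by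
  obtain ⟨φ, hφ⟩ := hP
  rw [← hφ M]
  have hdef : Absolute fun _ : α ⊕ β → ZFSet.{u} => True := ⟨⊤, by simp⟩
  exact realize_of_forall j φ (fun _ => True) s (fun x _ => (realize_iff hφ _).2 (h x)) x trivial

end Transfer

section BasicTransfer

variable {M : Set ZFSet.{u}} [IsTransitiveClass M]
  (j : setLanguage.ElementaryEmbedding ZFSet.{u} M)

theorem map_mem_map_iff {x y : ZFSet.{u}} : (j x : ZFSet.{u}) ∈ (j y : ZFSet.{u}) ↔ x ∈ y :=
  Absolute.map_iff j (fun v : Fin 2 → ZFSet.{u} => v 0 ∈ v 1) ![x, y]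

theorem map_pair (x y : ZFSet.{u}) : (j (ZFSet.pair x y) : ZFSet.{u}) = ZFSet.pair (j x) (j y) :=
  (Absolute.map_iff j (fun v : Fin 3 → ZFSet.{u} => v 0 = ZFSet.pair (v 1) (v 2))
    ![ZFSet.pair x y, x, y]).2 rfl

theorem map_insert_self (x : ZFSet.{u}) :
    (j (insert x x) : ZFSet.{u}) = insert (j x : ZFSet.{u}) (j x : ZFSet.{u}) :=
  (Absolute.map_iff j (fun v : Fin 2 → ZFSet.{u} => v 0 = insert (v 1) (v 1)) ![insert x x, x]).2
    rfl

theorem map_empty : (j ∅ : ZFSet.{u}) = ∅ :=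
  (Absolute.map_iff j (fun v : Fin 1 → ZFSet.{u} => v 0 = ∅) ![∅]).2 rfl

theorem isTransitive_map {x : ZFSet.{u}} (hx : x.IsTransitive) :
    (j x : ZFSet.{u}).IsTransitive :=
  (Absolute.map_iff j (fun v : Fin 1 → ZFSet.{u} => ∀ y ∈ v 0, y ⊆ v 0) ![x]).2 hx

theorem mem_of_mem_map {x y : ZFSet.{u}} (hx : x ∈ (j y : ZFSet.{u})) : x ∈ M :=
  IsTransitiveClass.mem_of_mem _ (j y).2 x hx

theorem mem_of_pair_mem_map {x y z : ZFSet.{u}} (h : ZFSet.pair x y ∈ (j z : ZFSet.{u})) :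
    x ∈ M ∧ y ∈ M := by
  have hxy : ({x, y} : ZFSet.{u}) ∈ M :=
    IsTransitiveClass.mem_of_mem _ (mem_of_mem_map j h) _ (by simp [ZFSet.pair])
  exact ⟨IsTransitiveClass.mem_of_mem _ hxy _ (by simp),
    IsTransitiveClass.mem_of_mem _ hxy _ (by simp)⟩

theorem mem_map_powerset {x W : ZFSet.{u}} (hW : W ∈ M) (h : W ⊆ (j x : ZFSet.{u})) :
    W ∈ (j (ZFSet.powerset x) : ZFSet.{u}) :=
  Absolute.of_forall j
    (fun v : Fin 2 ⊕ Unit → ZFSet.{u} => v (.inr ()) ⊆ v (.inl 0) → v (.inr ()) ∈ v (.inl 1))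
    ![x, ZFSet.powerset x] (fun _ => ZFSet.mem_powerset.2) (fun _ => ⟨W, hW⟩) h

theorem sep_mem {β : Type} [Finite β] (P : (β → ZFSet.{u}) → ZFSet.{u} → Prop)
    [hP : Absolute fun v : Option β → ZFSet.{u} => P (fun i => v (some i)) (v none)]
    (A : ZFSet.{u}) (v : β → M) : ZFSet.sep (P fun i => v i) (j A) ∈ M := by
  have hrename : Absolute fun v : Option (Option (Fin 2 ⊕ β)) → ZFSet.{u} =>
      P (fun i => v (some (some (.inr i)))) (v none) :=
    hP.comp fun i : Option β => i.elim none fun i => some (some (Sum.inr i))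
  obtain ⟨w, hmem, hsub, hsep⟩ := Absolute.of_forall j (fun v : Fin 2 ⊕ β → ZFSet.{u} =>
      ∃ w ∈ v (.inl 1), w ⊆ v (.inl 0) ∧ ∀ z ∈ v (.inl 0), z ∈ w ↔ P (fun i => v (.inr i)) z)
    ![A, ZFSet.powerset A]
    (fun v => ⟨ZFSet.sep (P v) A, ZFSet.mem_powerset.2 ZFSet.sep_subset, ZFSet.sep_subset,
      fun z hz => ZFSet.mem_sep.trans (and_iff_right hz)⟩) v
  have hw : w = ZFSet.sep (P fun i => v i) (j A) := by
    ext z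
    rw [ZFSet.mem_sep]
    exact ⟨fun hz => ⟨hsub hz, (hsep z (hsub hz)).1 hz⟩, fun hz => (hsep z hz.1).2 hz.2⟩
  rw [← hw]
  exact mem_of_mem_map j hmem

end BasicTransfer

section Functions

variable {K Y f x y z : ZFSet.{u}}

/-- The graph of the restriction to the set `K` of a class function. -/
def graph (K : ZFSet.{u}) (f : ZFSet.{u} → ZFSet.{u}) : ZFSet.{u} :=
  ZFSet.range fun x : K => ZFSet.pair x (f x)

theorem mem_graph {f : ZFSet.{u} → ZFSet.{u}} :
    z ∈ graph K f ↔ ∃ x ∈ K, ZFSet.pair x (f x) = z := by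
  simp [graph]

theorem pair_mem_graph {f : ZFSet.{u} → ZFSet.{u}} :
    ZFSet.pair x y ∈ graph K f ↔ x ∈ K ∧ f x = y := by
  simp only [mem_graph, ZFSet.pair_inj]
  exact ⟨fun ⟨_, hx, rfl, h⟩ => ⟨hx, h⟩, fun ⟨hx, h⟩ => ⟨x, hx, rfl, h⟩⟩

theorem isFunc_graph {f : ZFSet.{u} → ZFSet.{u}} (hf : ∀ x ∈ K, f x ∈ Y) :
    ZFSet.IsFunc K Y (graph K f) := by
  refine ⟨fun z hz => ?_, fun x hx => ⟨f x, pair_mem_graph.2 ⟨hx, rfl⟩, fun y hy => ?_⟩⟩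
  · obtain ⟨x, hx, rfl⟩ := mem_graph.1 hz
    exact ZFSet.pair_mem_prod.2 ⟨hx, hf x hx⟩
  · exact (pair_mem_graph.1 hy).2.symm

/-- The value at `x` of a function coded by a set of pairs; meaningless outside its domain. -/
def applySet (f x : ZFSet.{u}) : ZFSet.{u} := Classical.epsilon fun y => ZFSet.pair x y ∈ f

theorem pair_applySet_mem (hf : ZFSet.IsFunc K Y f) (hx : x ∈ K) :
    ZFSet.pair x (applySet f x) ∈ f :=
  Classical.epsilon_spec (p := fun y => ZFSet.pair x y ∈ f) (hf.2 x hx).exists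

theorem applySet_eq_iff (hf : ZFSet.IsFunc K Y f) (hx : x ∈ K) :
    applySet f x = y ↔ ZFSet.pair x y ∈ f :=
  ⟨fun h => h ▸ pair_applySet_mem hf hx, (hf.2 x hx).unique (pair_applySet_mem hf hx)⟩

/-- The first component of an ordered pair; meaningless if `z` is not an ordered pair. -/
def fst (z : ZFSet.{u}) : ZFSet.{u} := Classical.epsilon fun x => ∃ y, z = ZFSet.pair x y

/-- The second component of an ordered pair; meaningless if `z` is not an ordered pair. -/
def snd (z : ZFSet.{u}) : ZFSet.{u} := Classical.epsilon fun y => ∃ x, z = ZFSet.pair x y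

@[simp]
theorem fst_pair (x y : ZFSet.{u}) : fst (ZFSet.pair x y) = x := by
  obtain ⟨y', h⟩ := Classical.epsilon_spec
    (p := fun x' => ∃ y', ZFSet.pair x y = ZFSet.pair x' y') ⟨x, y, rfl⟩
  exact (ZFSet.pair_inj.1 h).1.symm

@[simp]
theorem snd_pair (x y : ZFSet.{u}) : snd (ZFSet.pair x y) = y := by
  obtain ⟨x', h⟩ := Classical.epsilon_spec
    (p := fun y' => ∃ x', ZFSet.pair x y = ZFSet.pair x' y') ⟨y, x, rfl⟩
  exact (ZFSet.pair_inj.1 h).2.symm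

end Functions

section Value

variable {M : Set ZFSet.{u}} (j : setLanguage.ElementaryEmbedding ZFSet.{u} M)

/-- The value `j(f)(a)`, where `f` is restricted to the set `K`; meaningful for `a ∈ j(K)`. -/
def value (K : ZFSet.{u}) (f : ZFSet.{u} → ZFSet.{u}) (a : ZFSet.{u}) : M :=
  haveI : Nonempty M := ⟨j ∅⟩
  Classical.epsilon fun y : M => ZFSet.pair a y ∈ (j (graph K f) : ZFSet.{u})

variable [IsTransitiveClass M] {K a y : ZFSet.{u}}

theorem pair_mem_map_graph_iff (ha : a ∈ (j K : ZFSet.{u})) (f : ZFSet.{u} → ZFSet.{u}) :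
    ZFSet.pair a y ∈ (j (graph K f) : ZFSet.{u}) ↔ value j K f a = y := by
  have hspec : ZFSet.pair a (value j K f a) ∈ (j (graph K f) : ZFSet.{u}) := by
    obtain ⟨y, hy⟩ := (Absolute.map_iff j (fun v : Fin 2 → ZFSet.{u} =>
      ∀ x ∈ v 0, ∃ y, ZFSet.pair x y ∈ v 1) ![K, graph K f]).2
      (fun x hx => ⟨f x, pair_mem_graph.2 ⟨hx, rfl⟩⟩) a ha
    have hyM : y ∈ M := (mem_of_pair_mem_map j hy).2
    exact Classical.epsilon_spec (p := fun y : M => ZFSet.pair a y ∈ (j (graph K f) : ZFSet.{u}))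
      ⟨⟨y, hyM⟩, hy⟩
  refine ⟨fun hy => ?_, fun h => h ▸ hspec⟩
  exact Absolute.of_forall j (fun v : Unit ⊕ Fin 3 → ZFSet.{u} =>
      ZFSet.pair (v (.inr 0)) (v (.inr 1)) ∈ v (.inl ()) →
      ZFSet.pair (v (.inr 0)) (v (.inr 2)) ∈ v (.inl ()) → v (.inr 1) = v (.inr 2))
    (fun _ => graph K f)
    (fun _ h h' => (pair_mem_graph.1 h).2.symm.trans (pair_mem_graph.1 h').2)
    ![⟨a, (mem_of_pair_mem_map j hy).1⟩, value j K f a, ⟨y, (mem_of_pair_mem_map j hy).2⟩] hspec hy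

theorem realize_value {α ι : Type} [Finite ι] (φ : setLanguage.Formula (α ⊕ ι))
    (s : α → ZFSet.{u}) (f : ι → ZFSet.{u} → ZFSet.{u})
    (h : ∀ x ∈ K, φ.Realize (Sum.elim s fun i => f i x)) (ha : a ∈ (j K : ZFSet.{u})) :
    φ.Realize (Sum.elim (fun i => j (s i)) fun i => value j K (f i) a) := by
  have key := realize_of_forall (β := Option ι) j
    (φ.relabel (Sum.elim (fun i => Sum.inl (Sum.inl i)) fun i => Sum.inr (some i)))
    (fun v : (α ⊕ Option ι) ⊕ Option ι → ZFSet.{u} =>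
      v (.inr none) ∈ v (.inl (.inr none)) ∧
        ∀ i, ZFSet.pair (v (.inr none)) (v (.inr (some i))) ∈ v (.inl (.inr (some i))))
    (Sum.elim s fun i => i.elim K fun i => graph K (f i)) ?_
    (fun i => i.elim ⟨a, mem_of_mem_map j ha⟩ fun i => value j K (f i) a)
    ⟨ha, fun i => (pair_mem_map_graph_iff j ha _).2 rfl⟩
  · rw [Formula.realize_relabel] at key
    convert key using 1
    funext i
    cases i <;> rfl
  · rintro x ⟨hx, hgraph⟩
    rw [Formula.realize_relabel]
    convert h (x none) hx using 1
    funext i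
    rcases i with i | i
    · rfl
    · exact (pair_mem_graph.1 (hgraph i)).2.symm

theorem Absolute.value_of_forall {α ι : Type} [Finite ι] (P : (α ⊕ ι → ZFSet.{u}) → Prop)
    [hP : Absolute P] (s : α → ZFSet.{u}) (f : ι → ZFSet.{u} → ZFSet.{u})
    (h : ∀ x ∈ K, P (Sum.elim s fun i => f i x)) (ha : a ∈ (j K : ZFSet.{u})) :
    P fun i => (Sum.elim (fun i => j (s i)) (fun i => value j K (f i) a) i : M) := by
  obtain ⟨φ, hφ⟩ := hP
  rw [← hφ M]
  exact realize_value j φ s f (fun x hx => (realize_iff hφ _).2 (h x hx)) ha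

theorem value_const (ha : a ∈ (j K : ZFSet.{u})) (x : ZFSet.{u}) :
    value j K (fun _ => x) a = j x :=
  Subtype.ext <| Absolute.value_of_forall j
    (fun v : Unit ⊕ Unit → ZFSet.{u} => v (.inr ()) = v (.inl ()))
    (fun _ => x) (fun _ _ => x) (fun _ _ => rfl) ha

theorem value_id (ha : a ∈ (j K : ZFSet.{u})) : (value j K (fun x => x) a : ZFSet.{u}) = a := by
  have hdiag : ∀ x ∈ K, ZFSet.pair x x ∈ graph K fun x => x :=
    fun x hx => pair_mem_graph.2 ⟨hx, rfl⟩
  exact (pair_mem_map_graph_iff j ha _).1 <| (Absolute.map_iff j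
    (fun v : Fin 2 → ZFSet.{u} => ∀ x ∈ v 0, ZFSet.pair x x ∈ v 1) ![K, graph K fun x => x]).2
    hdiag a ha

theorem value_comp {f g : ZFSet.{u} → ZFSet.{u}} (ha : a ∈ (j K : ZFSet.{u}))
    (hga : (value j K g a : ZFSet.{u}) ∈ (j K : ZFSet.{u})) :
    value j K (fun x => f (g x)) a = value j K f (value j K g a) :=
  Subtype.ext <| Eq.symm <| (pair_mem_map_graph_iff j hga f).1 <| Absolute.value_of_forall j
    (fun v : Fin 2 ⊕ Fin 2 → ZFSet.{u} => v (.inr 0) ∈ v (.inl 0) →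
      ZFSet.pair (v (.inr 0)) (v (.inr 1)) ∈ v (.inl 1))
    ![K, graph K f] ![g, fun x => f (g x)] (fun _ _ hg => pair_mem_graph.2 ⟨hg, rfl⟩) ha hga

theorem value_fst {b : ZFSet.{u}} (hab : ZFSet.pair a b ∈ (j K : ZFSet.{u})) :
    (value j K fst (ZFSet.pair a b) : ZFSet.{u}) = a := by
  have h := Absolute.value_of_forall j (fun v : Empty ⊕ Fin 2 → ZFSet.{u} =>
      (∃ x y, v (.inr 0) = ZFSet.pair x y) →
        ∃ x y, v (.inr 0) = ZFSet.pair x y ∧ v (.inr 1) = x)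
    nofun ![fun z => z, fst] (by rintro _ - ⟨x, y, rfl⟩; exact ⟨x, y, rfl, fst_pair x y⟩) hab
  obtain ⟨x, y, hxy, hx⟩ := h ⟨a, b, value_id j hab⟩
  exact hx.trans (ZFSet.pair_inj.1 (hxy.symm.trans (value_id j hab))).1

theorem value_snd {b : ZFSet.{u}} (hab : ZFSet.pair a b ∈ (j K : ZFSet.{u})) :
    (value j K snd (ZFSet.pair a b) : ZFSet.{u}) = b := by
  have h := Absolute.value_of_forall j (fun v : Empty ⊕ Fin 2 → ZFSet.{u} =>
      (∃ x y, v (.inr 0) = ZFSet.pair x y) →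
        ∃ x y, v (.inr 0) = ZFSet.pair x y ∧ v (.inr 1) = y)
    nofun ![fun z => z, snd] (by rintro _ - ⟨x, y, rfl⟩; exact ⟨x, y, rfl, snd_pair x y⟩) hab
  obtain ⟨x, y, hxy, hy⟩ := h ⟨a, b, value_id j hab⟩
  exact hy.trans (ZFSet.pair_inj.1 (hxy.symm.trans (value_id j hab))).2

end Value

section Condensation

variable {α : Type*} {r : α → α → Prop} (hr : WellFounded r) [∀ x, Small.{u} {y // r y x}]

/-- The Mostowski collapse of a well-founded set-like relation. -/
def mostowski : α → ZFSet.{u} :=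
  hr.fix fun x ih => ZFSet.range fun y : {y // r y x} => ih y y.2

theorem mem_mostowski {x : α} {z : ZFSet.{u}} :
    z ∈ mostowski hr x ↔ ∃ y, r y x ∧ mostowski hr y = z := by
  rw [mostowski, hr.fix_eq, ZFSet.mem_range]
  simp

theorem mostowski_injective (hext : ∀ x y, (∀ z, r z x ↔ r z y) → x = y) :
    Function.Injective (mostowski hr) := by
  intro x
  induction x using hr.induction with
  | h x ih =>
    intro y hxy
    refine hext x y fun z => ⟨fun hz => ?_, fun hz => ?_⟩
    · obtain ⟨w, hw, hwz⟩ := (mem_mostowski hr).1 (hxy ▸ (mem_mostowski hr).2 ⟨z, hz, rfl⟩)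
      rwa [ih z hz hwz.symm]
    · obtain ⟨w, hw, hwz⟩ := (mem_mostowski hr).1 (hxy ▸ (mem_mostowski hr).2 ⟨z, hz, rfl⟩)
      rwa [← ih w hw hwz]

variable {M : Set ZFSet.{u}} [IsTransitiveClass M] (S : setLanguage.ElementarySubstructure M)

theorem exists_mem_elementarySubstructure {α : Type} (P : (α ⊕ Unit → ZFSet.{u}) → Prop)
    [hP : Absolute P] (v : α → S)
    (h : ∃ x : M, P fun i => (Sum.elim (fun i => (v i : M)) (fun _ => x) i : M)) :
    ∃ x : S, P fun i => (Sum.elim (fun i => (v i : M)) (fun _ => (x : M)) i : M) := by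
  obtain ⟨φ, hφ⟩ := hP
  obtain ⟨x, hx⟩ := h
  have hM : (φ.iExs Unit).Realize (S.subtype ∘ v) :=
    Formula.realize_iExs.2 ⟨fun _ => x, (hφ M _).2 hx⟩
  obtain ⟨y, hy⟩ := Formula.realize_iExs.1 ((S.subtype.map_formula _ v).1 hM)
  refine ⟨y (), (hφ M _).1 ?_⟩
  rw [← S.subtype.map_formula] at hy
  convert hy using 1
  funext i
  cases i <;> rfl

theorem elementarySubstructure_ext (x y : S)
    (h : ∀ z : S, ((z : M) : ZFSet.{u}) ∈ (x : M).1 ↔ ((z : M) : ZFSet.{u}) ∈ (y : M).1) :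
    x = y := by
  by_contra hxy
  obtain ⟨z, hz⟩ : ∃ z, ¬ (z ∈ (x : M).1 ↔ z ∈ (y : M).1) := by
    by_contra! hz
    exact hxy (Subtype.ext (Subtype.ext (ZFSet.ext hz)))
  have hzM : z ∈ M := by
    by_contra hzM
    exact hz ⟨fun hzx => absurd (IsTransitiveClass.mem_of_mem _ (x : M).2 z hzx) hzM,
      fun hzy => absurd (IsTransitiveClass.mem_of_mem _ (y : M).2 z hzy) hzM⟩
  obtain ⟨w, hw⟩ := exists_mem_elementarySubstructure S (fun v : Fin 2 ⊕ Unit → ZFSet.{u} =>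
    ¬ (v (.inr ()) ∈ v (.inl 0) ↔ v (.inr ()) ∈ v (.inl 1))) ![x, y] ⟨⟨z, hzM⟩, hz⟩
  exact hw (h w)

theorem exists_isTransitiveClass_elementaryEmbedding :
    ∃ N : Set ZFSet.{u}, IsTransitiveClass N ∧
      ∃ k : setLanguage.ElementaryEmbedding N M, Set.range k = S := by
  have hwf : WellFounded fun y x : S => ((y : M) : ZFSet.{u}) ∈ (x : M).1 :=
    InvImage.wf (fun x : S => ((x : M) : ZFSet.{u})) ZFSet.mem_wf
  have (x : S) : Small.{u} {y : S // ((y : M) : ZFSet.{u}) ∈ (x : M).1} :=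
    small_of_injective (β := (x : M).1) (f := fun y => ⟨y.1, y.2⟩) fun y z h =>
      Subtype.ext (Subtype.ext (Subtype.ext (Subtype.mk.inj h)))
  have hinj := mostowski_injective hwf (elementarySubstructure_ext S)
  let π : setLanguage.Equiv S (Set.range (mostowski hwf)) :=
    { Equiv.ofInjective _ hinj with
      map_fun' := fun f => nomatch f
      map_rel' := fun {n} (r : SetRel n) x => match n, r, x with
        | _, SetRel.mem, x => by
          change mostowski hwf (x 0) ∈ mostowski hwf (x 1) ↔ ((x 0 : M) : ZFSet.{u}) ∈ (x 1 : M).1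
          rw [mem_mostowski]
          exact ⟨fun ⟨y, hy, hyx⟩ => hinj hyx ▸ hy, fun h => ⟨_, h, rfl⟩⟩ }
  refine ⟨_, ⟨?_⟩, S.subtype.comp π.symm.toElementaryEmbedding, ?_⟩
  · rintro _ ⟨x, rfl⟩ y hy
    obtain ⟨z, -, rfl⟩ := (mem_mostowski hwf).1 hy
    exact ⟨z, rfl⟩
  · ext x
    constructor
    · rintro ⟨y, rfl⟩
      exact (π.symm y).2
    · exact fun hx => ⟨π ⟨x, hx⟩, congrArg Subtype.val (π.symm_apply_apply ⟨x, hx⟩)⟩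

theorem elementaryEmbedding_eq_self {N : Set ZFSet.{u}} [IsTransitiveClass N]
    (k : setLanguage.ElementaryEmbedding N M) {T : ZFSet.{u}} (hT : T.IsTransitive)
    (hrange : ∀ a ∈ T, ∃ y : N, (k y : ZFSet.{u}) = a) {y : N} (hy : (k y : ZFSet.{u}) ∈ T) :
    (k y : ZFSet.{u}) = y := by
  obtain ⟨y, hyN⟩ := y
  induction y using ZFSet.inductionOn with
  | h y ih =>
    have ih' (z : N) (hz : (z : ZFSet.{u}) ∈ y) : (k z : ZFSet.{u}) = z :=
      ih z hz z.2 (hT.mem_trans ((mem_iff_of_class k (y := ⟨y, hyN⟩)).2 hz) hy)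
    ext z
    constructor
    · intro hz
      obtain ⟨z, rfl⟩ := hrange z (hT.mem_trans hz hy)
      have hzy := (mem_iff_of_class k (y := ⟨y, hyN⟩)).1 hz
      rwa [ih' z hzy]
    · intro hz
      lift z to N using IsTransitiveClass.mem_of_mem _ hyN z hz
      have hzy := (mem_iff_of_class k (y := ⟨y, hyN⟩)).2 hz
      rwa [ih' z hz] at hzy

end Condensation

section SeedHull

variable {M : Set ZFSet.{u}} (j : setLanguage.ElementaryEmbedding ZFSet.{u} M) (K A : ZFSet.{u})

/-- `A` is a set of seeds for `j`: the measures on `K` derived from its elements are defined, and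
finitely many seeds are coded by a single one. -/
structure IsSeedSet : Prop where
  subset : A ⊆ (j K : ZFSet.{u})
  nonempty : A.Nonempty
  pair_mem : ∀ a ∈ A, ∀ b ∈ A, ZFSet.pair a b ∈ A

/-- The seed hull: the class of all `j(f)(a)` with `a ∈ A`. -/
def seedHull : Set M := {x | ∃ a ∈ A, ∃ f : ZFSet.{u} → ZFSet.{u}, value j K f a = x}

variable {j K A} [IsTransitiveClass M]

theorem exists_realize_value {ι : Type} [Finite ι] (φ : setLanguage.Formula (ι ⊕ Unit))
    (f : ι → ZFSet.{u} → ZFSet.{u}) {a : ZFSet.{u}} (ha : a ∈ (j K : ZFSet.{u}))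
    (h : ∃ y : M, φ.Realize (Sum.elim (fun i => value j K (f i) a) fun _ => y)) :
    ∃ F, φ.Realize (Sum.elim (fun i => value j K (f i) a) fun _ => value j K F a) := by
  have hskolem (x : ZFSet.{u}) : ∃ y, (∃ z, φ.Realize (Sum.elim (fun i => f i x) fun _ => z)) →
      φ.Realize (Sum.elim (fun i => f i x) fun _ => y) := by
    by_cases hx : ∃ z, φ.Realize (Sum.elim (fun i => f i x) fun _ => z)
    · exact hx.imp fun _ hz _ => hz
    · exact ⟨∅, fun hz => absurd hz hx⟩
  choose F hF using hskolem
  let ψ : setLanguage.Formula (ι ⊕ Unit) := ((φ.iExs Unit).relabel Sum.inl).imp φ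
  have hψ {X : Type (u + 1)} [setLanguage.Structure X] (v : ι → X) (y : X) :
      ψ.Realize (Sum.elim v fun _ => y) ↔
        ((∃ z, φ.Realize (Sum.elim v fun _ => z)) → φ.Realize (Sum.elim v fun _ => y)) := by
    simp only [ψ, Formula.realize_imp, Formula.realize_relabel, Formula.realize_iExs,
      Sum.elim_comp_inl]
    exact imp_congr_left ⟨fun ⟨z, hz⟩ => ⟨z (), hz⟩, fun ⟨z, hz⟩ => ⟨fun _ => z, hz⟩⟩
  have hvalue := realize_value (α := Empty) j (ψ.relabel Sum.inr) nofun (Sum.elim f fun _ => F)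
    (fun x _ => ?_) ha
  · rw [Formula.realize_relabel, Sum.elim_comp_inr] at hvalue
    refine ⟨F, (hψ _ _).1 ?_ h⟩
    convert hvalue using 1
    funext i
    cases i <;> rfl
  · rw [Formula.realize_relabel, Sum.elim_comp_inr]
    convert (hψ _ _).2 (hF x) using 1
    funext i
    cases i <;> rfl

namespace IsSeedSet

variable (hA : IsSeedSet j K A)
include hA

theorem value_pair_left {a b : ZFSet.{u}} (ha : a ∈ A) (hb : b ∈ A)
    (f : ZFSet.{u} → ZFSet.{u}) :
    value j K (fun z => f (fst z)) (ZFSet.pair a b) = value j K f a := by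
  have hab := hA.subset (hA.pair_mem a ha b hb)
  rw [value_comp j hab, value_fst j hab]
  rw [value_fst j hab]
  exact hA.subset ha

theorem value_pair_right {a b : ZFSet.{u}} (ha : a ∈ A) (hb : b ∈ A)
    (f : ZFSet.{u} → ZFSet.{u}) :
    value j K (fun z => f (snd z)) (ZFSet.pair a b) = value j K f b := by
  have hab := hA.subset (hA.pair_mem a ha b hb)
  rw [value_comp j hab, value_snd j hab]
  rw [value_snd j hab]
  exact hA.subset hb

theorem exists_common_seed {n : ℕ} (x : Fin n → M) (hx : ∀ i, x i ∈ seedHull j K A) :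
    ∃ a ∈ A, ∃ f : Fin n → ZFSet.{u} → ZFSet.{u}, ∀ i, value j K (f i) a = x i := by
  induction n with
  | zero =>
    obtain ⟨a, ha⟩ := hA.nonempty
    exact ⟨a, ha, nofun, nofun⟩
  | succ n ih =>
    obtain ⟨a, ha, f, hf⟩ := ih (Fin.tail x) fun i => hx i.succ
    obtain ⟨b, hb, g, hg⟩ := hx 0
    refine ⟨ZFSet.pair b a, hA.pair_mem b hb a ha,
      Fin.cons (fun z => g (fst z)) fun i z => f i (snd z), Fin.cases ?_ fun i => ?_⟩
    · exact (hA.value_pair_left hb ha g).trans hg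
    · exact (hA.value_pair_right hb ha (f i)).trans (hf i)

theorem exists_elementarySubstructure :
    ∃ S : setLanguage.ElementarySubstructure M, (S : Set M) = seedHull j K A := by
  let S : setLanguage.Substructure M := ⟨seedHull j K A, fun f => nomatch f⟩
  refine ⟨S.toElementarySubstructure fun n φ x y hy => ?_, rfl⟩
  obtain ⟨a, ha, f, hf⟩ := hA.exists_common_seed (fun i => (x i : M)) fun i => (x i).2
  let ψ : setLanguage.Formula (Fin n ⊕ Unit) :=
    φ.toFormula.relabel (Sum.elim nofun (Fin.snoc Sum.inl (Sum.inr ())))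
  have hψ (y : M) : ψ.Realize (Sum.elim (fun i => value j K (f i) a) fun _ => y) ↔
      φ.Realize default (Fin.snoc ((↑) ∘ x) y : _ → M) := by
    simp only [ψ, Formula.realize_relabel, BoundedFormula.realize_toFormula]
    refine iff_of_eq (congrArg₂ _ (Subsingleton.elim _ _) (funext fun i => ?_))
    induction i using Fin.lastCases with
    | last => simp
    | cast i => simp [hf]
  obtain ⟨F, hF⟩ := exists_realize_value ψ f (hA.subset ha) ⟨y, (hψ y).2 hy⟩
  exact ⟨⟨_, a, ha, F, rfl⟩, (hψ _).1 hF⟩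

end IsSeedSet

end SeedHull

section GeneratedEmbedding

variable {M : Set ZFSet.{u}} {j : setLanguage.ElementaryEmbedding ZFSet.{u} M} {K A : ZFSet.{u}}

theorem exists_factor {N : Set ZFSet.{u}} (k : setLanguage.ElementaryEmbedding N M)
    (h : ∀ x, j x ∈ Set.range k) :
    ∃ i : setLanguage.ElementaryEmbedding ZFSet.{u} N, ∀ x, k (i x) = j x := by
  choose g hg using h
  refine ⟨⟨g, fun n φ v => ?_⟩, hg⟩
  rw [← k.map_formula, ← j.map_formula]
  exact iff_of_eq (congrArg _ (funext fun i => hg (v i)))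

variable [IsTransitiveClass M]

theorem IsSeedSet.map_mem_seedHull (hA : IsSeedSet j K A) (x : ZFSet.{u}) :
    j x ∈ seedHull j K A := by
  obtain ⟨a, ha⟩ := hA.nonempty
  exact ⟨a, ha, fun _ => x, value_const j (hA.subset ha) x⟩

theorem IsSeedSet.exists_mem_seedHull_eq (hA : IsSeedSet j K A) {a : ZFSet.{u}} (ha : a ∈ A) :
    ∃ x ∈ seedHull j K A, (x : ZFSet.{u}) = a :=
  ⟨_, ⟨a, ha, _, rfl⟩, value_id j (hA.subset ha)⟩

theorem map_value {N : Set ZFSet.{u}} [IsTransitiveClass N]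
    {i : setLanguage.ElementaryEmbedding ZFSet.{u} N} (k : setLanguage.ElementaryEmbedding N M)
    (hk : ∀ x, k (i x) = j x) {a : N} (ha : (a : ZFSet.{u}) ∈ (i K : ZFSet.{u}))
    (f : ZFSet.{u} → ZFSet.{u}) : k (value i K f a) = value j K f (k a) := by
  have haj : (k a : ZFSet.{u}) ∈ (j K : ZFSet.{u}) := by
    rw [← hk]
    exact (mem_iff_of_class k).2 ha
  refine Subtype.ext (Eq.symm ((pair_mem_map_graph_iff j haj f).1 ?_))
  rw [← hk]
  exact (Absolute.map_iff_of_class k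
    (fun v : Fin 3 → ZFSet.{u} => ZFSet.pair (v 0) (v 1) ∈ v 2)
    ![a, value i K f a, i (graph K f)]).2 ((pair_mem_map_graph_iff i ha f).2 rfl)

theorem IsSeedSet.exists_generated (hA : IsSeedSet j K A) (hAt : A.IsTransitive) :
    ∃ N : Set ZFSet.{u}, ∃ _ : IsTransitiveClass N,
      ∃ i : setLanguage.ElementaryEmbedding ZFSet.{u} N,
        (∀ x, ∀ a ∈ A, a ∈ (i x : ZFSet.{u}) ↔ a ∈ (j x : ZFSet.{u})) ∧
        (∀ x, ∀ a ∈ A, (i x : ZFSet.{u}) = a ↔ (j x : ZFSet.{u}) = a) ∧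
        seedHull i K A = Set.univ := by
  obtain ⟨S, hS⟩ := hA.exists_elementarySubstructure
  obtain ⟨N, hN, k, hk⟩ := exists_isTransitiveClass_elementaryEmbedding S
  rw [hS] at hk
  obtain ⟨i, hi⟩ := exists_factor k fun x => hk ▸ hA.map_mem_seedHull x
  have hrange (a : ZFSet.{u}) (ha : a ∈ A) : ∃ y : N, (k y : ZFSet.{u}) = a := by
    obtain ⟨x, hx, rfl⟩ := hA.exists_mem_seedHull_eq ha
    rw [← hk] at hx
    exact hx.imp fun y hy => congrArg Subtype.val hy
  have hself {y : N} : (k y : ZFSet.{u}) ∈ A → (k y : ZFSet.{u}) = y :=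
    elementaryEmbedding_eq_self k hAt hrange
  have hfix (a : ZFSet.{u}) (ha : a ∈ A) :
      ∃ y : N, (y : ZFSet.{u}) = a ∧ (k y : ZFSet.{u}) = a := by
    obtain ⟨y, rfl⟩ := hrange a ha
    exact ⟨y, (hself ha).symm, rfl⟩
  have hmem (x a : ZFSet.{u}) (ha : a ∈ A) : a ∈ (i x : ZFSet.{u}) ↔ a ∈ (j x : ZFSet.{u}) := by
    obtain ⟨y, rfl, hy⟩ := hfix a ha
    rw [← hi, ← mem_iff_of_class k, hy]
  refine ⟨N, hN, i, hmem, fun x a ha => ?_, Set.eq_univ_of_forall fun y => ?_⟩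
  · rw [← hi]
    obtain ⟨y, rfl, hy⟩ := hfix a ha
    exact ⟨fun h => Subtype.ext h ▸ hy, fun h => (hself (h ▸ ha)).symm.trans h⟩
  · obtain ⟨a, ha, f, hf⟩ : k y ∈ seedHull j K A := hk ▸ Set.mem_range_self y
    obtain ⟨b, rfl, hb⟩ := hfix a ha
    refine ⟨b, ha, f, k.injective ?_⟩
    rw [map_value k hi ((hmem K b ha).2 (hA.subset ha)), hb, hf]

end GeneratedEmbedding

section VonNeumann

variable {θ : Ordinal.{u}} {x y : ZFSet.{u}}

theorem pair_mem_vonNeumann_iff (hθ : Order.IsSuccLimit θ) :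
    ZFSet.pair x y ∈ V_ θ ↔ x ∈ V_ θ ∧ y ∈ V_ θ := by
  simp only [ZFSet.mem_vonNeumann, ZFSet.pair, ZFSet.rank_pair, ZFSet.rank_singleton, max_lt_iff,
    hθ.succ_lt_iff, and_self_left]

theorem powerset_mem_vonNeumann (hθ : Order.IsSuccLimit θ) (hx : x ∈ V_ θ) :
    ZFSet.powerset x ∈ V_ θ := by
  rw [ZFSet.mem_vonNeumann] at hx ⊢
  rw [ZFSet.rank_powerset]
  exact hθ.succ_lt hx

theorem prod_mem_vonNeumann (hθ : Order.IsSuccLimit θ) (hx : x ∈ V_ θ) (hy : y ∈ V_ θ) :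
    ZFSet.prod x y ∈ V_ θ := by
  have hxy : x ∪ y ∈ V_ θ := by
    rw [ZFSet.mem_vonNeumann] at hx hy ⊢
    rw [ZFSet.rank_union]
    exact max_lt hx hy
  rw [ZFSet.prod, ZFSet.pairSep]
  exact ZFSet.mem_vonNeumann_of_subset ZFSet.sep_subset
    (powerset_mem_vonNeumann hθ (powerset_mem_vonNeumann hθ hxy))

theorem funs_mem_vonNeumann (hθ : Order.IsSuccLimit θ) (hx : x ∈ V_ θ) (hy : y ∈ V_ θ) :
    ZFSet.funs x y ∈ V_ θ :=
  ZFSet.mem_vonNeumann_of_subset ZFSet.sep_subset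
    (powerset_mem_vonNeumann hθ (prod_mem_vonNeumann hθ hx hy))

end VonNeumann

section Generated

variable {κ : Cardinal.{u}} {θ : Ordinal.{u}}

theorem pair_mem_derivedExtender (e : StrongnessEmbedding κ θ) {a X : ZFSet.{u}} :
    ZFSet.pair a X ∈ derivedExtender e ↔ a ∈ V_ θ ∧ X ⊆ V_ κ.ord ∧ a ∈ (e.j X : ZFSet.{u}) := by
  rw [derivedExtender, ZFSet.mem_sep, ZFSet.pair_mem_prod, ZFSet.mem_powerset, and_assoc]
  refine and_congr_right' (and_congr_right' ⟨?_, fun h => ⟨a, X, rfl, h⟩⟩)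
  rintro ⟨a, X, h, ha⟩
  obtain ⟨rfl, rfl⟩ := ZFSet.pair_inj.1 h
  exact ha

theorem derivedExtender_subset (e : StrongnessEmbedding κ θ) (hθ : Order.IsSuccLimit θ)
    (hκ : κ.ord < θ) : derivedExtender e ⊆ V_ θ := by
  intro z hz
  obtain ⟨a, ha, X, hX, rfl⟩ := ZFSet.mem_prod.1 (ZFSet.sep_subset hz)
  exact (pair_mem_vonNeumann_iff hθ).2 ⟨ha, ZFSet.mem_vonNeumann_of_subset
    (ZFSet.mem_powerset.1 hX) (ZFSet.vonNeumann_mem_of_lt hκ)⟩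

namespace StrongnessEmbedding

/-- The embedding is the ultrapower embedding by the extender derived from it: every element of its
target has the form `j(f)(a)` with `f` a function on `V_κ` and `a ∈ V_θ`. -/
structure IsGenerated (e : StrongnessEmbedding κ θ) : Prop where
  isSeedSet : IsSeedSet e.j (V_ κ.ord) (V_ θ)
  seedHull_eq : seedHull e.j (V_ κ.ord) (V_ θ) = Set.univ

theorem isSeedSet (e : StrongnessEmbedding κ θ) (hθ : Order.IsSuccLimit θ)
    (he : V_ θ ⊆ (e.j (V_ κ.ord) : ZFSet.{u})) : IsSeedSet e.j (V_ κ.ord) (V_ θ) where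
  subset := he
  nonempty := ⟨V_ 0, ZFSet.vonNeumann_mem_of_lt hθ.bot_lt⟩
  pair_mem _ ha _ hb := (pair_mem_vonNeumann_iff hθ).2 ⟨ha, hb⟩

theorem exists_isGenerated (e : StrongnessEmbedding κ θ) (hθ : Order.IsSuccLimit θ)
    (hκ : κ.ord < θ) (he : V_ θ ⊆ (e.j (V_ κ.ord) : ZFSet.{u})) :
    ∃ e' : StrongnessEmbedding κ θ, e'.IsGenerated ∧
      ∀ x, ∀ a ∈ V_ θ, a ∈ (e'.j x : ZFSet.{u}) ↔ a ∈ (e.j x : ZFSet.{u}) := by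
  have hord {α : Ordinal.{u}} (hα : α < θ) : α.toZFSet ∈ V_ θ := by
    rwa [ZFSet.mem_vonNeumann, Ordinal.rank_toZFSet]
  obtain ⟨N, hN, i, hmem, heq, hhull⟩ :=
    (e.isSeedSet hθ he).exists_generated (ZFSet.isTransitive_vonNeumann θ)
  have hsubset : V_ θ ⊆ (i (V_ κ.ord) : ZFSet.{u}) := fun a ha => (hmem _ a ha).2 (he ha)
  let e' : StrongnessEmbedding κ θ :=
    { M := N
      transitive := hN.mem_of_mem
      j := i
      fixes_below := fun α hα => (heq _ _ (hord (hα.trans hκ))).2 (e.fixes_below α hα)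
      moves := fun h => e.moves ((heq _ _ (hord hκ)).1 h)
      vonNeumann_subset := fun a ha => mem_of_mem_map i (hsubset ha) }
  exact ⟨e', ⟨e'.isSeedSet hθ hsubset, hhull⟩, hmem⟩

theorem IsGenerated.exists_value_eq {e : StrongnessEmbedding κ θ} (he : e.IsGenerated) (x : e.M) :
    ∃ a ∈ V_ θ, ∃ f, value e.j (V_ κ.ord) f a = x :=
  he.seedHull_eq.ge (Set.mem_univ x)

end StrongnessEmbedding

theorem IsExtender.exists_isGenerated {E : ZFSet.{u}} (hE : IsExtender κ θ E)
    (hθ : Order.IsSuccLimit θ) (hκ : κ.ord < θ) :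
    ∃ e : StrongnessEmbedding κ θ, e.IsGenerated ∧ E = derivedExtender e := by
  obtain ⟨e, he, rfl⟩ := hE
  obtain ⟨e', he', hmem⟩ := e.exists_isGenerated hθ hκ he
  refine ⟨e', he', ZFSet.ext fun z => ?_⟩
  rw [derivedExtender, derivedExtender, ZFSet.mem_sep, ZFSet.mem_sep]
  refine and_congr_right fun hz => exists₂_congr fun a X => and_congr_right ?_
  rintro rfl
  exact (hmem X a (ZFSet.pair_mem_prod.1 hz).1).symm

end Generated

section Ultrapower

theorem IsSeedSet.pair_mem_map_sep_iff {M : Set ZFSet.{u}} [IsTransitiveClass M]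
    {j : setLanguage.ElementaryEmbedding ZFSet.{u} M} {K A : ZFSet.{u}} (hA : IsSeedSet j K A)
    (R : ZFSet.{u} → ZFSet.{u} → ZFSet.{u} → Prop)
    [hR : Absolute fun v : Fin 3 → ZFSet.{u} => R (v 0) (v 1) (v 2)] (p : ZFSet.{u})
    {a b : ZFSet.{u}} (ha : a ∈ A) (hb : b ∈ A) (f g : ZFSet.{u} → ZFSet.{u}) :
    ZFSet.pair a b ∈
        (j (ZFSet.sep (fun z => ∃ x y, z = ZFSet.pair x y ∧ R p (f x) (g y)) K) : ZFSet.{u}) ↔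
      R (j p) (value j K f a) (value j K g b) := by
  have hab := hA.subset (hA.pair_mem a ha b hb)
  set S := ZFSet.sep (fun z => ∃ x y, z = ZFSet.pair x y ∧ R p (f x) (g y)) K
  have hmem (x y : ZFSet.{u}) (hz : ZFSet.pair x y ∈ K) :
      ZFSet.pair x y ∈ S ↔ R p (f x) (g y) := by
    rw [ZFSet.mem_sep, and_iff_right hz]
    refine ⟨?_, fun h => ⟨x, y, rfl, h⟩⟩
    rintro ⟨x', y', h, hR⟩
    obtain ⟨rfl, rfl⟩ := ZFSet.pair_inj.1 h
    exact hR
  have hRv : Absolute fun v : Fin 2 ⊕ Fin 3 → ZFSet.{u} =>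
      R (v (.inl 1)) (v (.inr 1)) (v (.inr 2)) := hR.comp ![Sum.inl 1, Sum.inr 1, Sum.inr 2]
  have key := Absolute.value_of_forall j
    (fun v : Fin 2 ⊕ Fin 3 → ZFSet.{u} => (∃ x y, v (.inr 0) = ZFSet.pair x y) →
      (v (.inr 0) ∈ v (.inl 0) ↔ R (v (.inl 1)) (v (.inr 1)) (v (.inr 2))))
    ![S, p] ![fun z => z, fun z => f (fst z), fun z => g (snd z)] ?_ hab
  · have hid := value_id j hab
    have hiff : (value j K (fun z => z) (ZFSet.pair a b) : ZFSet.{u}) ∈ (j S : ZFSet.{u}) ↔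
        R (j p) (value j K (fun z => f (fst z)) (ZFSet.pair a b))
          (value j K (fun z => g (snd z)) (ZFSet.pair a b)) := key ⟨a, b, hid⟩
    rwa [hid, hA.value_pair_left ha hb, hA.value_pair_right ha hb] at hiff
  · rintro _ hz ⟨x, y, rfl⟩
    change ZFSet.pair x y ∈ S ↔ R p (f (fst (ZFSet.pair x y))) (g (snd (ZFSet.pair x y)))
    rw [hmem x y hz, fst_pair, snd_pair]

variable {κ : Cardinal.{u}} {θ : Ordinal.{u}}

theorem ultRel_derivedExtender_iff {e : StrongnessEmbedding κ θ}
    (he : IsSeedSet e.j (V_ κ.ord) (V_ θ)) (R : ZFSet.{u} → ZFSet.{u} → ZFSet.{u} → Prop)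
    [Absolute fun v : Fin 3 → ZFSet.{u} => R (v 0) (v 1) (v 2)] (p : ZFSet.{u})
    {a b : ZFSet.{u}} (ha : a ∈ V_ θ) (hb : b ∈ V_ θ) (f g : ZFSet.{u} → ZFSet.{u}) :
    UltRel κ (derivedExtender e) (R p) a f b g ↔
      R (e.j p) (value e.j (V_ κ.ord) f a) (value e.j (V_ κ.ord) g b) := by
  rw [UltRel, pair_mem_derivedExtender, and_iff_right (he.pair_mem a ha b hb),
    and_iff_right ZFSet.sep_subset]
  exact he.pair_mem_map_sep_iff R p ha hb f g

theorem StrongnessEmbedding.IsGenerated.isCollapsedUltrapower {e : StrongnessEmbedding κ θ}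
    (he : e.IsGenerated) : IsCollapsedUltrapower κ θ (derivedExtender e) e.M
      fun a f => value e.j (V_ κ.ord) f a where
  transitive := e.transitive
  range_eq x := by
    refine ⟨fun hx => ?_, ?_⟩
    · obtain ⟨a, ha, f, hf⟩ := he.exists_value_eq ⟨x, hx⟩
      exact ⟨a, ha, f, congrArg Subtype.val hf⟩
    · rintro ⟨a, -, f, rfl⟩
      exact Subtype.prop _
  eq_iff _ ha _ hb f g :=
    (ultRel_derivedExtender_iff he.isSeedSet (fun _ x y => x = y) ∅ ha hb f g).symm
  mem_iff _ ha _ hb f g :=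
    (ultRel_derivedExtender_iff he.isSeedSet (fun _ x y => x ∈ y) ∅ ha hb f g).symm

namespace IsCollapsedUltrapower

variable {F : ZFSet.{u}} {N N' : Set ZFSet.{u}}
  {π π' : ZFSet.{u} → (ZFSet.{u} → ZFSet.{u}) → ZFSet.{u}}

theorem exists_eq_of_mem (h : IsCollapsedUltrapower κ θ F N π) {a z : ZFSet.{u}}
    {f : ZFSet.{u} → ZFSet.{u}} (ha : a ∈ V_ θ) (hz : z ∈ π a f) :
    ∃ b ∈ V_ θ, ∃ g, π b g = z ∧ UltRel κ F (· ∈ ·) b g a f := by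
  obtain ⟨b, hb, g, rfl⟩ :=
    (h.range_eq z).1 (h.transitive _ ((h.range_eq _).2 ⟨a, ha, f, rfl⟩) z hz)
  exact ⟨b, hb, g, rfl, (h.mem_iff b hb a ha g f).1 hz⟩

theorem apply_eq (h : IsCollapsedUltrapower κ θ F N π) (h' : IsCollapsedUltrapower κ θ F N' π')
    {a : ZFSet.{u}} (ha : a ∈ V_ θ) (f : ZFSet.{u} → ZFSet.{u}) : π a f = π' a f := by
  induction hx : π a f using ZFSet.inductionOn generalizing a f with
  | h x ih =>
    subst hx
    ext z
    constructor
    · intro hz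
      obtain ⟨b, hb, g, rfl, hbg⟩ := h.exists_eq_of_mem ha hz
      rw [ih _ hz hb g rfl]
      exact (h'.mem_iff b hb a ha g f).2 hbg
    · intro hz
      obtain ⟨b, hb, g, rfl, hbg⟩ := h'.exists_eq_of_mem ha hz
      have hmem := (h.mem_iff b hb a ha g f).2 hbg
      rwa [← ih _ hmem hb g rfl]

theorem unique (h : IsCollapsedUltrapower κ θ F N π) (h' : IsCollapsedUltrapower κ θ F N' π') :
    N = N' := by
  ext x
  rw [h.range_eq, h'.range_eq]
  exact exists_congr fun a => and_congr_right fun ha => exists_congr fun f => by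
    rw [h.apply_eq h' ha f]

end IsCollapsedUltrapower

theorem mitchellOrder_iff_mem {e : StrongnessEmbedding κ θ} (he : e.IsGenerated)
    {E F : {E : ZFSet.{u} // IsExtender κ θ E}} (hF : F.1 = derivedExtender e) :
    MitchellOrder κ θ E F ↔ E.1 ∈ e.M := by
  have hM := hF ▸ he.isCollapsedUltrapower
  exact ⟨fun ⟨_, _, hN, hE⟩ => hN.unique hM ▸ hE, fun hE => ⟨_, _, hM, hE⟩⟩

end Ultrapower

section Relations

universe v

/-- The height of a well-founded relation, the supremum of the successors of the ranks. -/
def relHeight {α : Type v} (r : α → α → Prop) [IsWellFounded α r] : Ordinal.{v} :=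
  ⨆ x, Order.succ (IsWellFounded.rank r x)

theorem rank_le_rank_of_map {α β : Type v} {r : α → α → Prop} {s : β → β → Prop}
    [IsWellFounded α r] [IsWellFounded β s] {f : α → β} (hf : ∀ x y, r x y → s (f x) (f y))
    (x : α) : IsWellFounded.rank r x ≤ IsWellFounded.rank s (f x) := by
  induction x using IsWellFounded.induction r with
  | ind x ih =>
    rw [IsWellFounded.rank_eq r]
    exact Ordinal.iSup_le fun y => Order.succ_le_of_lt <|
      (ih y y.2).trans_lt (IsWellFounded.rank_lt_of_rel (hf y x y.2))

theorem relHeight_lt_relHeight {α β : Type v} {r : α → α → Prop} {s : β → β → Prop}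
    [IsWellFounded α r] [IsWellFounded β s] {f : α → β} (hf : ∀ x y, r x y → s (f x) (f y))
    {b : β} (hb : ∀ x, s (f x) b) : relHeight r < relHeight s := by
  have hle : relHeight r ≤ IsWellFounded.rank s b :=
    Ordinal.iSup_le fun x => Order.succ_le_of_lt <|
      (rank_le_rank_of_map hf x).trans_lt (IsWellFounded.rank_lt_of_rel (hb x))
  exact hle.trans_lt <| (Order.lt_succ _).trans_le <|
    Ordinal.le_iSup (fun y => Order.succ (IsWellFounded.rank s y)) b

/-- The binary relation coded by a set of ordered pairs. -/
def relOf (W p q : ZFSet.{u}) : Prop := ZFSet.pair p q ∈ W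

theorem mem_sUnion_sUnion_of_relOf {W p q : ZFSet.{u}} (h : relOf W p q) :
    p ∈ ⋃₀ (⋃₀ W) ∧ q ∈ ⋃₀ (⋃₀ W) := by
  have hpq : ({p, q} : ZFSet.{u}) ∈ ⋃₀ W := ZFSet.mem_sUnion.2 ⟨_, h, by simp [ZFSet.pair]⟩
  exact ⟨ZFSet.mem_sUnion.2 ⟨_, hpq, by simp⟩, ZFSet.mem_sUnion.2 ⟨_, hpq, by simp⟩⟩

instance (W q : ZFSet.{u}) : Small.{u} {p // relOf W p q} :=
  small_of_injective (β := (⋃₀ (⋃₀ W) : ZFSet.{u}))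
    (f := fun p => ⟨p, (mem_sUnion_sUnion_of_relOf p.2).1⟩)
    fun _ _ h => by simpa only [Subtype.mk.injEq, Subtype.val_inj] using h

theorem relOf_map_imp_value_mostowski_mem {M : Set ZFSet.{u}} [IsTransitiveClass M]
    (j : setLanguage.ElementaryEmbedding ZFSet.{u} M) {l : ZFSet.{u}}
    (hl : WellFounded (relOf l)) {p q : ZFSet.{u}} (h : relOf (j l) p q) :
    (value j (⋃₀ (⋃₀ l)) (mostowski hl) p : ZFSet.{u}) ∈
      (value j (⋃₀ (⋃₀ l)) (mostowski hl) q : ZFSet.{u}) := by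
  have hpM := mem_of_pair_mem_map j h
  set D := ⋃₀ (⋃₀ l)
  obtain ⟨hp, hq⟩ := Absolute.of_forall j (fun v : Fin 2 ⊕ Fin 2 → ZFSet.{u} =>
      ZFSet.pair (v (.inr 0)) (v (.inr 1)) ∈ v (.inl 0) →
        v (.inr 0) ∈ v (.inl 1) ∧ v (.inr 1) ∈ v (.inl 1))
    ![l, D] (fun _ => mem_sUnion_sUnion_of_relOf) ![⟨p, hpM.1⟩, ⟨q, hpM.2⟩] h
  exact Absolute.of_forall j (fun v : Fin 2 ⊕ Fin 4 → ZFSet.{u} =>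
      ZFSet.pair (v (.inr 0)) (v (.inr 1)) ∈ v (.inl 0) →
      ZFSet.pair (v (.inr 0)) (v (.inr 2)) ∈ v (.inl 1) →
      ZFSet.pair (v (.inr 1)) (v (.inr 3)) ∈ v (.inl 1) → v (.inr 2) ∈ v (.inr 3))
    ![l, graph D (mostowski hl)]
    (fun _ hpq hu hv => (pair_mem_graph.1 hv).2 ▸
      (mem_mostowski hl).2 ⟨_, hpq, (pair_mem_graph.1 hu).2⟩)
    ![⟨p, hpM.1⟩, ⟨q, hpM.2⟩, value j D (mostowski hl) p, value j D (mostowski hl) q] h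
    ((pair_mem_map_graph_iff j hp _).2 rfl) ((pair_mem_map_graph_iff j hq _).2 rfl)

instance {M : Set ZFSet.{u}} [IsTransitiveClass M]
    (j : setLanguage.ElementaryEmbedding ZFSet.{u} M) (l : ZFSet.{u})
    [hl : IsWellFounded _ (relOf l)] : IsWellFounded _ (relOf (j l)) :=
  ⟨Subrelation.wf (relOf_map_imp_value_mostowski_mem j hl.wf) (InvImage.wf _ ZFSet.mem_wf)⟩

end Relations

section WellFoundedSum

variable {K W : ZFSet.{u}}

/-- The field of the relation `wfSum K`. -/
def wfSumField (K : ZFSet.{u}) : ZFSet.{u} :=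
  ZFSet.prod (ZFSet.powerset (ZFSet.prod K K)) (insert K K)

/-- The disjoint sum of all well-founded relations `W` on `K`, each of them with an additional
largest element. The copies in `W` of a point `p` of `K` and of the largest element are coded by
`(W, p)` and `(W, K)`. -/
def wfSum (K : ZFSet.{u}) : ZFSet.{u} :=
  ZFSet.sep (fun z => ∃ W p q, z = ZFSet.pair (ZFSet.pair W p) (ZFSet.pair W q) ∧
    WellFounded (relOf W) ∧ p ∈ K ∧ (relOf W p q ∨ q = K))
    (ZFSet.prod (wfSumField K) (wfSumField K))

theorem wfSum_subset (K : ZFSet.{u}) : wfSum K ⊆ ZFSet.prod (wfSumField K) (wfSumField K) :=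
  ZFSet.sep_subset

theorem relOf_wfSum_iff {d d' : ZFSet.{u}} :
    relOf (wfSum K) d d' ↔ ∃ W p q, d = ZFSet.pair W p ∧ d' = ZFSet.pair W q ∧
      W ⊆ ZFSet.prod K K ∧ WellFounded (relOf W) ∧ p ∈ K ∧ (relOf W p q ∨ q = K) := by
  rw [relOf, wfSum, ZFSet.mem_sep]
  constructor
  · rintro ⟨hmem, W, p, q, h, hwf, hp, hpq⟩
    obtain ⟨rfl, rfl⟩ := ZFSet.pair_inj.1 h
    have hd := (ZFSet.pair_mem_prod.1 hmem).1
    exact ⟨W, p, q, rfl, rfl, ZFSet.mem_powerset.1 (ZFSet.pair_mem_prod.1 hd).1, hwf, hp, hpq⟩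
  · rintro ⟨W, p, q, rfl, rfl, hW, hwf, hp, hpq⟩
    have hq : q ∈ insert K K := ZFSet.mem_insert_iff.2 <|
      hpq.symm.imp_right fun h => (ZFSet.pair_mem_prod.1 (hW h)).2
    have hmem {r : ZFSet.{u}} (hr : r ∈ insert K K) : ZFSet.pair W r ∈ wfSumField K :=
      ZFSet.pair_mem_prod.2 ⟨ZFSet.mem_powerset.2 hW, hr⟩
    exact ⟨ZFSet.pair_mem_prod.2 ⟨hmem (ZFSet.mem_insert_of_mem _ hp), hmem hq⟩,
      W, p, q, rfl, hwf, hp, hpq⟩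

instance (K : ZFSet.{u}) : IsWellFounded _ (relOf (wfSum K)) := by
  have hacc {W : ZFSet.{u}} (hwf : WellFounded (relOf W)) (p : ZFSet.{u}) (hp : p ∈ K) :
      Acc (relOf (wfSum K)) (ZFSet.pair W p) := by
    induction p using hwf.induction with
    | h p ih =>
      refine ⟨_, fun d hd => ?_⟩
      obtain ⟨W', q, p', rfl, h, -, -, hq, hqp⟩ := relOf_wfSum_iff.1 hd
      obtain ⟨rfl, rfl⟩ := ZFSet.pair_inj.1 h
      obtain hqp | rfl := hqp
      · exact ih q hqp hq
      · exact absurd hp (ZFSet.mem_irrefl _)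
  refine ⟨⟨fun d => ⟨_, fun d' hd' => ?_⟩⟩⟩
  obtain ⟨W, p, q, rfl, -, -, hwf, hp, -⟩ := relOf_wfSum_iff.1 hd'
  exact hacc hwf p hp

/-- Unlike the well-foundedness of `W`, this dichotomy is visibly absolute, so that it can be
transferred along an embedding. -/
theorem exists_unfounded_subset_or_relOf_wfSum (hW : W ⊆ ZFSet.prod K K) :
    (∃ w ∈ ZFSet.powerset K, w ≠ ∅ ∧ ∀ q ∈ w, ∃ p ∈ w, relOf W p q) ∨
      ∀ p ∈ K, ∀ q, relOf W p q ∨ q = K →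
        relOf (wfSum K) (ZFSet.pair W p) (ZFSet.pair W q) := by
  by_cases hwf : WellFounded (relOf W)
  · exact .inr fun p hp q hpq => relOf_wfSum_iff.2 ⟨W, p, q, rfl, rfl, hW, hwf, hp, hpq⟩
  · rw [WellFounded.wellFounded_iff_has_min] at hwf
    push Not at hwf
    obtain ⟨s, ⟨q₀, hq₀⟩, hs⟩ := hwf
    have hpred {q : ZFSet.{u}} (hq : q ∈ s) : ∃ p ∈ ZFSet.sep (· ∈ s) K, relOf W p q := by
      obtain ⟨p, hp, hpq⟩ := hs q hq
      exact ⟨p, ZFSet.mem_sep.2 ⟨(ZFSet.pair_mem_prod.1 (hW hpq)).1, hp⟩, hpq⟩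
    obtain ⟨p₀, hp₀, -⟩ := hpred hq₀
    exact .inl ⟨_, ZFSet.mem_powerset.2 ZFSet.sep_subset,
      fun h => (ZFSet.eq_empty _).1 h p₀ hp₀, fun q hq => hpred (ZFSet.mem_sep.1 hq).2⟩

end WellFoundedSum

section Decode

variable {M : Set ZFSet.{u}} [IsTransitiveClass M]
  (j : setLanguage.ElementaryEmbedding ZFSet.{u} M) {K W p q : ZFSet.{u}}

theorem relOf_map_wfSum (hWM : W ∈ M) (hW : W ⊆ ZFSet.prod (j K) (j K))
    (hwf : WellFounded (relOf W)) (hp : p ∈ (j K : ZFSet.{u})) (hpq : relOf W p q ∨ q = j K) :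
    relOf (j (wfSum K)) (ZFSet.pair W p) (ZFSet.pair W q) := by
  have hqM : q ∈ M := by
    obtain hpq | rfl := hpq
    · exact mem_of_mem_map j (ZFSet.pair_mem_prod.1 (hW hpq)).2
    · exact (j K).2
  obtain ⟨w, -, hne, hw⟩ | ⟨_, ht, _, _, rfl, rfl, rfl⟩ :=
    Absolute.of_forall j (fun v : Fin 3 ⊕ Fin 3 → ZFSet.{u} =>
      (∀ z ∈ v (.inr 0), ∃ x y, z = ZFSet.pair x y ∧ (x ∈ v (.inl 0) ∧ y ∈ v (.inl 0))) →
      v (.inr 1) ∈ v (.inl 0) →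
      (ZFSet.pair (v (.inr 1)) (v (.inr 2)) ∈ v (.inr 0) ∨ v (.inr 2) = v (.inl 0)) →
      (∃ w ∈ v (.inl 1), ¬ w = ∅ ∧ ∀ y ∈ w, ∃ x ∈ w, ZFSet.pair x y ∈ v (.inr 0)) ∨
        ∃ t ∈ v (.inl 2), ∃ d d', t = ZFSet.pair d d' ∧
          (d = ZFSet.pair (v (.inr 0)) (v (.inr 1)) ∧ d' = ZFSet.pair (v (.inr 0)) (v (.inr 2))))
    ![K, ZFSet.powerset K, wfSum K]
    (fun v hW hp hpq => by
      have hsub : v 0 ⊆ ZFSet.prod K K := fun z hz => by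
        obtain ⟨x, y, rfl, hxy⟩ := hW z hz
        exact ZFSet.pair_mem_prod.2 hxy
      exact (exists_unfounded_subset_or_relOf_wfSum hsub).imp_right fun h =>
        ⟨_, h _ hp _ hpq, _, _, rfl, rfl, rfl⟩)
    ![⟨W, hWM⟩, ⟨p, mem_of_mem_map j hp⟩, ⟨q, hqM⟩]
    (fun z hz => by
      obtain ⟨x, hx, y, hy, rfl⟩ := ZFSet.mem_prod.1 (hW hz)
      exact ⟨x, y, rfl, hx, hy⟩) hp hpq
  · obtain ⟨x, hx⟩ := (ZFSet.eq_empty_or_nonempty w).resolve_left hne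
    obtain ⟨y, hy, hmin⟩ := hwf.has_min {y | y ∈ w} ⟨x, hx⟩
    obtain ⟨z, hz, hzy⟩ := hw y hy
    exact absurd hzy (hmin z hz)
  · exact ht

/-- The element `j(f)(a)` coded by a pair `z = (a, f)`, where `f` is itself a set. -/
def decode (K z : ZFSet.{u}) : M := value j K (applySet (snd z)) (fst z)

open Classical in
theorem exists_decode_eq {Y a : ZFSet.{u}} {f : ZFSet.{u} → ZFSet.{u}} (hY : Y.Nonempty)
    (ha : a ∈ (j K : ZFSet.{u})) (hf : (value j K f a : ZFSet.{u}) ∈ (j Y : ZFSet.{u})) :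
    ∃ g ∈ ZFSet.funs K Y, decode j K (ZFSet.pair a g) = value j K f a := by
  obtain ⟨y, hy⟩ := hY
  have hg : ZFSet.IsFunc K Y (graph K fun x => if f x ∈ Y then f x else y) :=
    isFunc_graph fun x _ => by split_ifs with h <;> assumption
  refine ⟨_, ZFSet.mem_funs.2 hg, Subtype.ext ?_⟩
  rw [decode, fst_pair, snd_pair]
  refine Absolute.value_of_forall j
    (fun v : Unit ⊕ Fin 2 → ZFSet.{u} => v (.inr 0) ∈ v (.inl ()) → v (.inr 1) = v (.inr 0))
    (fun _ => Y) ![f, applySet (graph K fun x => if f x ∈ Y then f x else y)]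
    (fun x hx h => (applySet_eq_iff hg hx).2 (pair_mem_graph.2 ⟨hx, if_pos h⟩)) ha hf

end Decode

section Height

variable {κ : Cardinal.{u}} {θ : Ordinal.{u}}

theorem StrongnessEmbedding.IsGenerated.exists_decode_eq {e : StrongnessEmbedding κ θ}
    (he : e.IsGenerated) {Y x : ZFSet.{u}} (hY : Y.Nonempty) (hx : x ∈ (e.j Y : ZFSet.{u})) :
    ∃ z ∈ ZFSet.prod (V_ θ) (ZFSet.funs (V_ κ.ord) Y),
      (decode e.j (V_ κ.ord) z : ZFSet.{u}) = x := by
  obtain ⟨a, ha, f, hf⟩ := he.exists_value_eq ⟨x, mem_of_mem_map e.j hx⟩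
  have hf' : (value e.j (V_ κ.ord) f a : ZFSet.{u}) = x := congrArg Subtype.val hf
  obtain ⟨g, hg, hdec⟩ :=
    StrongLaver.exists_decode_eq e.j hY (he.isSeedSet.subset ha) (hf' ▸ hx)
  exact ⟨_, ZFSet.pair_mem_prod.2 ⟨ha, hg⟩, hdec ▸ hf'⟩

/-- The pairs `((a, f), (b, g))` such that the measure with seed `(a, b)` given by `E` contains the
set assigned to `(f, g)` by the function `C`. -/
def IsUltrapowerPair (C E z : ZFSet.{u}) : Prop :=
  ∃ a f b g Z, z = ZFSet.pair (ZFSet.pair a f) (ZFSet.pair b g) ∧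
    ZFSet.pair (ZFSet.pair f g) Z ∈ C ∧ ZFSet.pair (ZFSet.pair a b) Z ∈ E

instance {α : Type} (C E z : α) :
    Absolute fun v : α → ZFSet.{u} => IsUltrapowerPair (v C) (v E) (v z) :=
  Absolute.congr (P := fun v => ∃ p q, v z = ZFSet.pair p q ∧ ∃ a f, p = ZFSet.pair a f ∧
      ∃ b g, q = ZFSet.pair b g ∧ ∃ t ∈ v C, ∃ m Z, t = ZFSet.pair m Z ∧
        (m = ZFSet.pair f g ∧ ∃ s ∈ v E, ∃ n Z', s = ZFSet.pair n Z' ∧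
          (n = ZFSet.pair a b ∧ Z' = Z)))
    inferInstance fun v => by
      constructor
      · rintro ⟨p, q, hz, a, f, rfl, b, g, rfl, _, ht, _, Z, rfl, rfl, _, hs, _, _, rfl, rfl, rfl⟩
        exact ⟨a, f, b, g, _, hz, ht, hs⟩
      · rintro ⟨a, f, b, g, Z, hz, ht, hs⟩
        exact ⟨_, _, hz, a, f, rfl, b, g, rfl, _, ht, _, _, rfl, rfl, _, hs, _, _, rfl, rfl, rfl⟩

/-- The function assigning to two functions `f, g : K → Y` the set of pairs `(x, y)` in `K` such
that `(f(x), g(y)) ∈ l`. -/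
def comparisonTable (K Y l : ZFSet.{u}) : ZFSet.{u} :=
  graph (ZFSet.prod (ZFSet.funs K Y) (ZFSet.funs K Y)) fun m =>
    ZFSet.sep (fun z => ∃ x y, z = ZFSet.pair x y ∧
      ZFSet.pair (applySet (fst m) x) (applySet (snd m) y) ∈ l) K

theorem pair_mem_comparisonTable {K Y l f g Z : ZFSet.{u}} :
    ZFSet.pair (ZFSet.pair f g) Z ∈ comparisonTable K Y l ↔
      (f ∈ ZFSet.funs K Y ∧ g ∈ ZFSet.funs K Y) ∧ ZFSet.sep (fun z => ∃ x y,
        z = ZFSet.pair x y ∧ ZFSet.pair (applySet f x) (applySet g y) ∈ l) K = Z := by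
  rw [comparisonTable, pair_mem_graph, ZFSet.pair_mem_prod, fst_pair, snd_pair]

theorem comparisonTable_mem_vonNeumann (hθ : Order.IsSuccLimit θ) {K Y : ZFSet.{u}}
    (hK : K ∈ V_ θ) (hY : Y ∈ V_ θ) (l : ZFSet.{u}) : comparisonTable K Y l ∈ V_ θ := by
  have hfuns := funs_mem_vonNeumann hθ hK hY
  exact ZFSet.mem_vonNeumann_of_subset
    (isFunc_graph fun _ _ => ZFSet.mem_powerset.2 ZFSet.sep_subset).1
    (prod_mem_vonNeumann hθ (prod_mem_vonNeumann hθ hfuns hfuns) (powerset_mem_vonNeumann hθ hK))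

theorem prod_funs_subset_vonNeumann (hθ : Order.IsSuccLimit θ) {K Y : ZFSet.{u}}
    (hK : K ∈ V_ θ) (hY : Y ∈ V_ θ) : ZFSet.prod (V_ θ) (ZFSet.funs K Y) ⊆ V_ θ := by
  intro z hz
  obtain ⟨a, ha, f, hf, rfl⟩ := ZFSet.mem_prod.1 hz
  exact (pair_mem_vonNeumann_iff hθ).2
    ⟨ha, ZFSet.isTransitive_vonNeumann θ _ (funs_mem_vonNeumann hθ hK hY) hf⟩

theorem isUltrapowerPair_comparisonTable_iff (hθ : Order.IsSuccLimit θ)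
    {e : StrongnessEmbedding κ θ} (he : IsSeedSet e.j (V_ κ.ord) (V_ θ)) (Y l p q : ZFSet.{u}) :
    IsUltrapowerPair (comparisonTable (V_ κ.ord) Y l) (derivedExtender e) (ZFSet.pair p q) ↔
      (p ∈ ZFSet.prod (V_ θ) (ZFSet.funs (V_ κ.ord) Y) ∧
        q ∈ ZFSet.prod (V_ θ) (ZFSet.funs (V_ κ.ord) Y)) ∧
      relOf (e.j l) (decode e.j (V_ κ.ord) p) (decode e.j (V_ κ.ord) q) := by
  have hiff {a b f g : ZFSet.{u}} (ha : a ∈ V_ θ) (hb : b ∈ V_ θ) :=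
    ultRel_derivedExtender_iff he (fun l x y => ZFSet.pair x y ∈ l) l ha hb (applySet f)
      (applySet g)
  constructor
  · rintro ⟨a, f, b, g, Z, h, hfg, hab⟩
    obtain ⟨rfl, rfl⟩ := ZFSet.pair_inj.1 h
    obtain ⟨⟨hf, hg⟩, rfl⟩ := pair_mem_comparisonTable.1 hfg
    obtain ⟨ha, hb⟩ := (pair_mem_vonNeumann_iff hθ).1 ((pair_mem_derivedExtender e).1 hab).1
    refine ⟨⟨ZFSet.pair_mem_prod.2 ⟨ha, hf⟩, ZFSet.pair_mem_prod.2 ⟨hb, hg⟩⟩, ?_⟩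
    rw [relOf, decode, decode, fst_pair, snd_pair, fst_pair, snd_pair]
    exact (hiff ha hb).1 hab
  · rintro ⟨⟨hp, hq⟩, h⟩
    obtain ⟨a, ha, f, hf, rfl⟩ := ZFSet.mem_prod.1 hp
    obtain ⟨b, hb, g, hg, rfl⟩ := ZFSet.mem_prod.1 hq
    rw [relOf, decode, decode, fst_pair, snd_pair, fst_pair, snd_pair] at h
    exact ⟨a, f, b, g, _, rfl, pair_mem_comparisonTable.2 ⟨⟨hf, hg⟩, rfl⟩, (hiff ha hb).2 h⟩

theorem exists_mem_relOf_iff_decode {M : Set ZFSet.{u}} [IsTransitiveClass M]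
    (j : setLanguage.ElementaryEmbedding ZFSet.{u} M) {A : ZFSet.{u}}
    (hA : V_ θ ⊆ (j A : ZFSet.{u})) (hθ : Order.IsSuccLimit θ) (hκ : κ.ord < θ)
    {e : StrongnessEmbedding κ θ} (he : IsSeedSet e.j (V_ κ.ord) (V_ θ))
    (hE : derivedExtender e ∈ M) {Y : ZFSet.{u}} (hY : Y ∈ V_ θ) (l : ZFSet.{u}) :
    ∃ W ∈ M, W ⊆ ZFSet.prod (V_ θ) (V_ θ) ∧ ∀ p q, relOf W p q ↔
      (p ∈ ZFSet.prod (V_ θ) (ZFSet.funs (V_ κ.ord) Y) ∧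
        q ∈ ZFSet.prod (V_ θ) (ZFSet.funs (V_ κ.ord) Y)) ∧
      relOf (e.j l) (decode e.j (V_ κ.ord) p) (decode e.j (V_ κ.ord) q) := by
  have hK : V_ κ.ord ∈ V_ θ := ZFSet.vonNeumann_mem_of_lt hκ
  have hsub := prod_funs_subset_vonNeumann hθ hK hY
  let C := comparisonTable (V_ κ.ord) Y l
  have hC : C ∈ M := mem_of_mem_map j (hA (comparisonTable_mem_vonNeumann hθ hK hY l))
  refine ⟨ZFSet.sep (IsUltrapowerPair C (derivedExtender e)) (j A),
    sep_mem j (fun v : Fin 2 → ZFSet.{u} => IsUltrapowerPair (v 0) (v 1)) A ![⟨C, hC⟩, ⟨_, hE⟩],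
    fun z hz => ?_, fun p q => ?_⟩
  · obtain ⟨-, a, f, b, g, Z, rfl, h⟩ := ZFSet.mem_sep.1 hz
    have hpq := ((isUltrapowerPair_comparisonTable_iff hθ he Y l _ _).1
      ⟨a, f, b, g, Z, rfl, h⟩).1
    exact ZFSet.pair_mem_prod.2 ⟨hsub hpq.1, hsub hpq.2⟩
  · rw [relOf, ZFSet.mem_sep, isUltrapowerPair_comparisonTable_iff hθ he]
    exact and_iff_right_of_imp fun h =>
      hA ((pair_mem_vonNeumann_iff hθ).2 ⟨hsub h.1.1, hsub h.1.2⟩)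

theorem wfSumField_nonempty (K : ZFSet.{u}) : (wfSumField K).Nonempty :=
  ⟨ZFSet.pair ∅ K, ZFSet.pair_mem_prod.2
    ⟨ZFSet.mem_powerset.2 (ZFSet.empty_subset _), ZFSet.mem_insert K K⟩⟩

theorem wfSumField_mem_vonNeumann (hθ : Order.IsSuccLimit θ) {K : ZFSet.{u}} (hK : K ∈ V_ θ) :
    wfSumField K ∈ V_ θ := by
  have hinsert : insert K K ∈ V_ θ := by
    rw [ZFSet.mem_vonNeumann] at hK ⊢
    rw [ZFSet.rank_insert]
    exact max_lt (hθ.succ_lt hK) hK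
  exact prod_mem_vonNeumann hθ
    (powerset_mem_vonNeumann hθ (prod_mem_vonNeumann hθ hK hK)) hinsert

theorem mem_map_wfSumField_of_relOf {M : Set ZFSet.{u}} [IsTransitiveClass M]
    (j : setLanguage.ElementaryEmbedding ZFSet.{u} M) {K d d' : ZFSet.{u}}
    (h : relOf (j (wfSum K)) d d') :
    d ∈ (j (wfSumField K) : ZFSet.{u}) ∧ d' ∈ (j (wfSumField K) : ZFSet.{u}) := by
  obtain ⟨hd, hd'⟩ := mem_of_pair_mem_map j h
  exact Absolute.of_forall j (fun v : Fin 2 ⊕ Fin 2 → ZFSet.{u} =>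
      ZFSet.pair (v (.inr 0)) (v (.inr 1)) ∈ v (.inl 0) →
        v (.inr 0) ∈ v (.inl 1) ∧ v (.inr 1) ∈ v (.inl 1))
    ![wfSum K, wfSumField K] (fun _ h => ZFSet.pair_mem_prod.1 (wfSum_subset K h))
    ![⟨d, hd⟩, ⟨d', hd'⟩] h

theorem relHeight_map_wfSum_lt (hθ : Order.IsSuccLimit θ) (hκ : κ.ord < θ)
    {e e' : StrongnessEmbedding κ θ} (he : IsSeedSet e.j (V_ κ.ord) (V_ θ)) (he' : e'.IsGenerated)
    (hE : derivedExtender e' ∈ e.M) :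
    relHeight (relOf (e'.j (wfSum (V_ κ.ord)))) < relHeight (relOf (e.j (wfSum (V_ κ.ord)))) := by
  set K := V_ κ.ord
  have hK : K ∈ V_ θ := ZFSet.vonNeumann_mem_of_lt hκ
  have hY := wfSumField_mem_vonNeumann hθ hK
  have hcode {p : ZFSet.{u}} (hp : p ∈ ZFSet.prod (V_ θ) (ZFSet.funs K (wfSumField K))) :
      p ∈ (e.j K : ZFSet.{u}) := he.subset (prod_funs_subset_vonNeumann hθ hK hY hp)
  obtain ⟨W, hWM, hWsub, hW⟩ :=
    exists_mem_relOf_iff_decode e.j he.subset hθ hκ he'.isSeedSet hE hY (wfSum K)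
  have hsub : W ⊆ ZFSet.prod (e.j K) (e.j K) := fun z hz => by
    obtain ⟨x, hx, y, hy, rfl⟩ := ZFSet.mem_prod.1 (hWsub hz)
    exact ZFSet.pair_mem_prod.2 ⟨he.subset hx, he.subset hy⟩
  have hwf : WellFounded (relOf W) := Subrelation.wf (fun h => ((hW _ _).1 h).2)
    (InvImage.wf (fun p => (decode e'.j K p : ZFSet.{u}))
      (IsWellFounded.wf (r := relOf (e'.j (wfSum K)))))
  obtain ⟨y, hy⟩ := wfSumField_nonempty K
  obtain ⟨p₀, hp₀, -⟩ := he'.exists_decode_eq ⟨y, hy⟩ ((map_mem_map_iff e'.j).2 hy)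
  have hcodes (d : ZFSet.{u}) : ∃ p ∈ ZFSet.prod (V_ θ) (ZFSet.funs K (wfSumField K)),
      d ∈ (e'.j (wfSumField K) : ZFSet.{u}) → (decode e'.j K p : ZFSet.{u}) = d := by
    by_cases hd : d ∈ (e'.j (wfSumField K) : ZFSet.{u})
    · obtain ⟨p, hp, hpd⟩ := he'.exists_decode_eq ⟨y, hy⟩ hd
      exact ⟨p, hp, fun _ => hpd⟩
    · exact ⟨p₀, hp₀, fun h => absurd h hd⟩
  choose code hmem hdecode using hcodes
  refine relHeight_lt_relHeight (f := fun d => ZFSet.pair W (code d))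
    (b := ZFSet.pair W (e.j K)) (fun d d' h => ?_) fun d =>
      relOf_map_wfSum e.j hWM hsub hwf (hcode (hmem d)) (.inr rfl)
  obtain ⟨hd, hd'⟩ := mem_map_wfSumField_of_relOf e'.j h
  refine relOf_map_wfSum e.j hWM hsub hwf (hcode (hmem d)) (.inl ((hW _ _).2
    ⟨⟨hmem d, hmem d'⟩, ?_⟩))
  rwa [hdecode d hd, hdecode d' hd']

theorem isWellFounded_mitchellOrder (hθ : Order.IsSuccLimit θ) (hκ : κ.ord < θ) :
    IsWellFounded _ (MitchellOrder κ θ) := by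
  choose e he hEe using fun E : {E : ZFSet.{u} // IsExtender κ θ E} =>
    E.2.exists_isGenerated hθ hκ
  refine ⟨Subrelation.wf (fun {E F} h => ?_)
    (InvImage.wf (fun E => relHeight (relOf ((e E).j (wfSum (V_ κ.ord))))) wellFounded_lt)⟩
  have hmem := (mitchellOrder_iff_mem (he F) (hEe F)).1 h
  exact relHeight_map_wfSum_lt hθ hκ (he F).isSeedSet (he E) (hEe E ▸ hmem)

end Height

section RankBounds

universe v

theorem rank_lt_ord_succ {α : Type v} {r : α → α → Prop} [IsWellFounded α r] {c : Cardinal.{v}}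
    (hc : ℵ₀ ≤ c) (hr : ∀ x, #{y // r y x} ≤ c) (x : α) :
    IsWellFounded.rank r x < (Order.succ c).ord := by
  induction x using IsWellFounded.induction r with
  | ind x ih =>
    rw [IsWellFounded.rank_eq]
    refine Ordinal.iSup_add_one_lt_of_lt_cof ?_ fun y => ih y y.2
    rw [(Cardinal.isRegular_succ hc).cof_ord, Order.lt_succ_iff]
    exact hr x

variable {κ : Cardinal.{u}} {θ : Ordinal.{u}}

theorem StrongnessEmbedding.omega0_lt_ord (e : StrongnessEmbedding κ θ) :
    Ordinal.omega0 < κ.ord := by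
  by_contra! hω
  have hpred : ∀ z ∈ κ.ord.toZFSet, z = ∅ ∨ ∃ y ∈ κ.ord.toZFSet, z = insert y y := by
    intro z hz
    obtain ⟨a, ha, rfl⟩ := Ordinal.mem_toZFSet_iff.1 hz
    obtain ⟨n, rfl⟩ := Ordinal.lt_omega0.1 (ha.trans_le hω)
    cases n with
    | zero => exact .inl (by rw [Nat.cast_zero, Ordinal.toZFSet_zero])
    | succ n =>
      rw [Nat.cast_succ] at ha ⊢
      exact .inr ⟨_, Ordinal.toZFSet_mem_toZFSet_iff.2 ((lt_add_one _).trans ha),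
        Ordinal.toZFSet_add_one _⟩
  have hpred' : ∀ z ∈ (e.j κ.ord.toZFSet : ZFSet.{u}),
      z = ∅ ∨ ∃ y ∈ (e.j κ.ord.toZFSet : ZFSet.{u}), z = insert y y :=
    (Absolute.map_iff e.j (fun v : Unit → ZFSet.{u} =>
      ∀ z ∈ v (), z = ∅ ∨ ∃ y ∈ v (), z = insert y y) fun _ => κ.ord.toZFSet).2 hpred
  have hfix {z : ZFSet.{u}} (hz : z ∈ κ.ord.toZFSet) : (e.j z : ZFSet.{u}) = z := by
    obtain ⟨a, ha, rfl⟩ := Ordinal.mem_toZFSet_iff.1 hz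
    exact e.fixes_below a ha
  refine e.moves (ZFSet.ext fun z => ⟨?_, fun hz => hfix hz ▸ (map_mem_map_iff e.j).2 hz⟩)
  induction z using ZFSet.inductionOn with
  | h z ih =>
    intro hz
    suffices hfixed : (e.j z : ZFSet.{u}) = z from (map_mem_map_iff e.j).1 (hfixed.symm ▸ hz)
    obtain rfl | ⟨y, hy, rfl⟩ := hpred' z hz
    · exact map_empty e.j
    · rw [map_insert_self, hfix (ih y (ZFSet.mem_insert y y) hy)]

theorem StrongnessEmbedding.card_vonNeumann (e : StrongnessEmbedding κ θ) (hκ : κ.ord < θ) :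
    (V_ θ).card = ℶ_ θ := by
  have hω := e.omega0_lt_ord
  have hκ_add : Ordinal.omega0 + κ.ord = κ.ord :=
    (Ordinal.isPrincipal_add_ord (Cardinal.omega0_le_ord.1 hω.le)).add_eq_right hω
  have hθ_add : Ordinal.omega0 + θ = θ := by
    rw [← Ordinal.add_sub_cancel_of_le hκ.le, ← add_assoc, hκ_add]
  rw [ZFSet.card_vonNeumann, Cardinal.beth_eq_preBeth, hθ_add]

theorem IsExtender.subset_vonNeumann {E : ZFSet.{u}} (hE : IsExtender κ θ E)
    (hθ : Order.IsSuccLimit θ) (hκ : κ.ord < θ) : E ⊆ V_ θ := by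
  obtain ⟨e, -, rfl⟩ := hE
  exact derivedExtender_subset e hθ hκ

theorem mk_mitchellOrder_le (hθ : Order.IsSuccLimit θ) (hκ : κ.ord < θ)
    (F : {E : ZFSet.{u} // IsExtender κ θ E}) :
    #{E // MitchellOrder κ θ E F} ≤ Cardinal.lift.{u + 1} (ℶ_ θ) := by
  obtain ⟨e, he, hF⟩ := F.2.exists_isGenerated hθ hκ
  have hK : V_ κ.ord ∈ V_ θ := ZFSet.vonNeumann_mem_of_lt hκ
  have hcode (E : {E // MitchellOrder κ θ E F}) :
      ∃ z ∈ V_ θ, (decode e.j (V_ κ.ord) z : ZFSet.{u}) = E.1.1 := by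
    have hEM := (mitchellOrder_iff_mem he hF).1 E.2
    have hEsub := (E.1.2.subset_vonNeumann hθ hκ).trans he.isSeedSet.subset
    obtain ⟨z, hz, hzE⟩ := he.exists_decode_eq ⟨∅, ZFSet.mem_powerset.2 (ZFSet.empty_subset _)⟩
      (mem_map_powerset e.j hEM hEsub)
    exact ⟨z, prod_funs_subset_vonNeumann hθ hK (powerset_mem_vonNeumann hθ hK) hz, hzE⟩
  choose code hmem hdecode using hcode
  rw [← e.card_vonNeumann hκ, ← ZFSet.cardinalMk_coe_sort]
  refine Cardinal.mk_le_of_injective (f := fun E => ⟨code E, hmem E⟩) fun E E' h => ?_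
  have hcode_eq : code E = code E' := congrArg Subtype.val h
  exact Subtype.ext (Subtype.ext (by rw [← hdecode, ← hdecode, hcode_eq]))

theorem mitchellRank_le (hθ : Order.IsSuccLimit θ) (hκ : κ.ord < θ)
    [IsWellFounded _ (MitchellOrder κ θ)] :
    mitchellRank κ θ ≤ Ordinal.lift.{u + 1} (Order.succ (ℶ_ θ)).ord := by
  rw [Cardinal.lift_ord, Cardinal.lift_succ]
  have hinf : ℵ₀ ≤ Cardinal.lift.{u + 1} (ℶ_ θ) :=
    Cardinal.aleph0_le_lift.2 (Cardinal.aleph0_le_beth θ)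
  exact Ordinal.iSup_le fun F =>
    Order.succ_le_of_lt (rank_lt_ord_succ hinf (mk_mitchellOrder_le hθ hκ) F)

end RankBounds

section GuessedUnion

variable {M : Set ZFSet.{u}} [IsTransitiveClass M]
  (j : setLanguage.ElementaryEmbedding ZFSet.{u} M) {K Y f x y y' : ZFSet.{u}}

theorem value_map (hx : x ∈ K) (f : ZFSet.{u} → ZFSet.{u}) :
    (value j K f (j x) : ZFSet.{u}) = j (f x) := by
  refine (pair_mem_map_graph_iff j ((map_mem_map_iff j).2 hx) f).1 ?_
  rw [← map_pair, map_mem_map_iff]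
  exact pair_mem_graph.2 ⟨hx, rfl⟩

theorem eq_of_pair_mem_map (hf : ZFSet.IsFunc K Y f) (h : ZFSet.pair x y ∈ (j f : ZFSet.{u}))
    (h' : ZFSet.pair x y' ∈ (j f : ZFSet.{u})) : y = y' := by
  obtain ⟨hx, hy⟩ := mem_of_pair_mem_map j h
  obtain ⟨-, hy'⟩ := mem_of_pair_mem_map j h'
  exact Absolute.of_forall j (fun v : Unit ⊕ Fin 3 → ZFSet.{u} =>
      ZFSet.pair (v (.inr 0)) (v (.inr 1)) ∈ v (.inl ()) →
      ZFSet.pair (v (.inr 0)) (v (.inr 2)) ∈ v (.inl ()) → v (.inr 1) = v (.inr 2))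
    (fun _ => f) (fun _ h h' => (hf.2 _ (ZFSet.pair_mem_prod.1 (hf.1 h)).1).unique h h')
    ![⟨x, hx⟩, ⟨y, hy⟩, ⟨y', hy'⟩] h h'

theorem mem_map_of_pair_mem_map (hf : ZFSet.IsFunc K Y f)
    (h : ZFSet.pair x y ∈ (j f : ZFSet.{u})) : y ∈ (j Y : ZFSet.{u}) := by
  obtain ⟨hx, hy⟩ := mem_of_pair_mem_map j h
  exact Absolute.of_forall j (fun v : Fin 2 ⊕ Fin 2 → ZFSet.{u} =>
      ZFSet.pair (v (.inr 0)) (v (.inr 1)) ∈ v (.inl 0) → v (.inr 1) ∈ v (.inl 1))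
    ![f, Y] (fun _ h => (ZFSet.pair_mem_prod.1 (hf.1 h)).2) ![⟨x, hx⟩, ⟨y, hy⟩] h

/-- The point `z` belongs to the first component of the value at `k` of one of the functions in the
sequence `T`, whose index set is `I`. -/
def IsGuessed (I T k z : ZFSet.{u}) : Prop :=
  ∃ ξ ∈ I, ∃ m, ZFSet.pair ξ m ∈ T ∧ ∃ b, ZFSet.pair k b ∈ m ∧ ∃ a c, b = ZFSet.pair a c ∧ z ∈ a

instance {α : Type} (I T k z : α) :
    Absolute fun v : α → ZFSet.{u} => IsGuessed (v I) (v T) (v k) (v z) := by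
  unfold IsGuessed
  infer_instance

end GuessedUnion

section JointLaver

variable {κ : Cardinal.{u}} {θ lam : Ordinal.{u}} {ℓ a b : Ordinal.{u} → ZFSet.{u}}

/-- The sequence `⟨ℓ α ; α < lam⟩` as a set. Its indices are the von Neumann ordinals, from which
`α` is recovered as the rank. -/
def sequenceGraph (lam : Ordinal.{u}) (ℓ : Ordinal.{u} → ZFSet.{u}) : ZFSet.{u} :=
  graph lam.toZFSet fun ξ => ℓ ξ.rank

theorem pair_mem_map_sequenceGraph_iff (e : StrongnessEmbedding κ θ) {α : Ordinal.{u}}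
    (hα : α < lam) (hακ : α < κ.ord) {m : ZFSet.{u}} :
    ZFSet.pair α.toZFSet m ∈ (e.j (sequenceGraph lam ℓ) : ZFSet.{u}) ↔ e.j (ℓ α) = m := by
  have hmem : α.toZFSet ∈ lam.toZFSet := Ordinal.toZFSet_mem_toZFSet_iff.2 hα
  rw [← e.fixes_below α hακ, sequenceGraph,
    pair_mem_map_graph_iff e.j ((map_mem_map_iff e.j).2 hmem), value_map e.j hmem,
    Ordinal.rank_toZFSet]

theorem isGuessed_iff {e : StrongnessEmbedding κ θ} (hlam : lam ≤ κ.ord)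
    (hℓ : ∀ α < lam, ∃ K Y, ZFSet.IsFunc K Y (ℓ α))
    (hg : ∀ α < lam, Guesses e (ℓ α) (ZFSet.pair (a α) (b α))) {z : ZFSet.{u}} :
    IsGuessed lam.toZFSet (e.j (sequenceGraph lam ℓ)) κ.ord.toZFSet z ↔ ∃ α < lam, z ∈ a α := by
  constructor
  · rintro ⟨_, hξ, m, hm, _, hb, u, v, rfl, hz⟩
    obtain ⟨α, hα, rfl⟩ := Ordinal.mem_toZFSet_iff.1 hξ
    obtain rfl := (pair_mem_map_sequenceGraph_iff e hα (hα.trans_le hlam)).1 hm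
    obtain ⟨K, Y, hf⟩ := hℓ α hα
    obtain ⟨rfl, -⟩ := ZFSet.pair_inj.1 (eq_of_pair_mem_map e.j hf hb (hg α hα))
    exact ⟨α, hα, hz⟩
  · rintro ⟨α, hα, hz⟩
    exact ⟨_, Ordinal.toZFSet_mem_toZFSet_iff.2 hα, _,
      (pair_mem_map_sequenceGraph_iff e hα (hα.trans_le hlam)).2 rfl, _, hg α hα, _, _, rfl, hz⟩

theorem StrongnessEmbedding.mem_of_guesses {e : StrongnessEmbedding κ θ}
    (he : V_ θ ⊆ (e.j (V_ κ.ord) : ZFSet.{u})) (hκ : κ.ord < θ) (hlam : lam ≤ κ.ord)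
    (hℓ : ∀ α < lam, ∃ K Y, ZFSet.IsFunc K Y (ℓ α))
    (hg : ∀ α < lam, Guesses e (ℓ α) (ZFSet.pair (a α) (b α))) {A : ZFSet.{u}} (hA : A ⊆ V_ θ)
    (hAa : ∀ z, z ∈ A ↔ ∃ α < lam, z ∈ a α) : A ∈ e.M := by
  have hord {α : Ordinal.{u}} (hα : α ≤ κ.ord) : α.toZFSet ∈ e.M :=
    e.vonNeumann_subset _ <| by
      rw [ZFSet.mem_vonNeumann, Ordinal.rank_toZFSet]
      exact hα.trans_lt hκ
  have hsep := sep_mem e.j (fun v : Fin 3 → ZFSet.{u} => IsGuessed (v 0) (v 1) (v 2)) (V_ κ.ord)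
    ![⟨_, hord hlam⟩, e.j (sequenceGraph lam ℓ), ⟨_, hord le_rfl⟩]
  convert hsep using 1
  ext z
  have hiff := isGuessed_iff hlam hℓ hg (z := z)
  rw [ZFSet.mem_sep, hAa, ← hiff]
  exact (and_iff_right_of_imp fun h => he (hA ((hAa z).2 (hiff.1 h)))).symm

theorem exists_cofinal_vonNeumann (hθ : Order.IsSuccLimit θ) :
    ∃ τ : Ordinal.{u} → Ordinal.{u}, (∀ α < θ.cof.ord, τ α < θ) ∧
      ∀ x ∈ V_ θ, ∃ α < θ.cof.ord, x ∈ V_ (τ α) := by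
  obtain ⟨t, ht⟩ := Ordinal.exists_isFundamentalSeq (o := θ) rfl
  let τ : Ordinal.{u} → Ordinal.{u} := Function.extend Subtype.val (fun α => (t α).1) 0
  have hτ (α : Set.Iio θ.cof.ord) : τ α = t α := Subtype.val_injective.extend_apply _ _ α
  refine ⟨τ, fun α hα => hτ ⟨α, hα⟩ ▸ (t ⟨α, hα⟩).2, fun x hx => ?_⟩
  rw [ZFSet.mem_vonNeumann] at hx
  obtain ⟨_, ⟨α, rfl⟩, hle⟩ := ht.isCofinal_range ⟨_, hθ.succ_lt hx⟩
  refine ⟨α, α.2, ?_⟩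
  rw [hτ, ZFSet.mem_vonNeumann]
  exact Order.succ_le_iff.1 hle

namespace IsJointLaverSequence

theorem exists_isGenerated_guesses (hℓ : IsJointLaverSequence κ θ lam ℓ)
    (hθ : Order.IsSuccLimit θ) (hκ : κ.ord < θ) (ha : ∀ α < lam, a α ∈ V_ θ)
    (hb : ∀ α < lam, b α ∈ V_ θ) (hcover : ∀ x ∈ V_ θ, ∃ α < lam, x ∈ b α) :
    ∃ e : StrongnessEmbedding κ θ, e.IsGenerated ∧
      ∀ α < lam, Guesses e (ℓ α) (ZFSet.pair (a α) (b α)) := by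
  have hab (α) (hα : α < lam) : ZFSet.pair (a α) (b α) ∈ V_ θ :=
    (pair_mem_vonNeumann_iff hθ).2 ⟨ha α hα, hb α hα⟩
  obtain ⟨e, he⟩ := hℓ.2 _ hab
  have hsubset : V_ θ ⊆ (e.j (V_ κ.ord) : ZFSet.{u}) := fun x hx => by
    obtain ⟨α, hα, hxα⟩ := hcover x hx
    have htrans := isTransitive_map e.j (ZFSet.isTransitive_vonNeumann κ.ord)
    have hmem := mem_map_of_pair_mem_map e.j (hℓ.1 α hα).1 (he α hα)
    have hpair : ({a α, b α} : ZFSet.{u}) ∈ (e.j (V_ κ.ord) : ZFSet.{u}) :=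
      htrans _ hmem (by simp [ZFSet.pair])
    exact htrans _ (htrans _ hpair (by simp)) hxα
  obtain ⟨e', he', hmem⟩ := e.exists_isGenerated hθ hκ hsubset
  have hκV : κ.ord.toZFSet ∈ V_ θ := by rwa [ZFSet.mem_vonNeumann, Ordinal.rank_toZFSet]
  exact ⟨e', he', fun α hα =>
    (hmem _ _ ((pair_mem_vonNeumann_iff hθ).2 ⟨hκV, hab α hα⟩)).2 (he α hα)⟩

theorem exists_isGenerated_mem (hℓ : IsJointLaverSequence κ θ θ.cof.ord ℓ)
    (hθ : Order.IsSuccLimit θ) (hcof : θ.cof ≤ κ) (hκ : κ.ord < θ) {A : ZFSet.{u}}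
    (hA : A ⊆ V_ θ) : ∃ e : StrongnessEmbedding κ θ, e.IsGenerated ∧ A ∈ e.M := by
  obtain ⟨τ, hτ, hcover⟩ := exists_cofinal_vonNeumann hθ
  have hV (α) (hα : α < θ.cof.ord) : V_ (τ α) ∈ V_ θ := ZFSet.vonNeumann_mem_of_lt (hτ α hα)
  -- Guessing the sets `V_ (τ α)` as well forces `V_ θ ⊆ j (V_ κ)`.
  obtain ⟨e, he, hg⟩ := hℓ.exists_isGenerated_guesses hθ hκ (a := fun α => A ∩ V_ (τ α))
    (b := fun α => V_ (τ α)) (fun α hα => ZFSet.mem_vonNeumann_of_subset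
      (fun z hz => (ZFSet.mem_inter.1 hz).2) (hV α hα)) hV hcover
  refine ⟨e, he, e.mem_of_guesses he.isSeedSet.subset hκ (Cardinal.ord_le_ord.2 hcof)
    (fun α hα => ⟨_, _, (hℓ.1 α hα).1⟩) hg hA fun z => ⟨fun hz => ?_, ?_⟩⟩
  · obtain ⟨α, hα, hzα⟩ := hcover z (hA hz)
    exact ⟨α, hα, ZFSet.mem_inter.2 ⟨hz, hzα⟩⟩
  · rintro ⟨α, -, hz⟩
    exact (ZFSet.mem_inter.1 hz).1

theorem exists_isGenerated_forall_mem (hℓ : IsJointLaverSequence κ θ θ.cof.ord ℓ)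
    (hθ : Order.IsSuccLimit θ) (hcof : θ.cof ≤ κ) (hκ : κ.ord < θ) {E : ZFSet.{u} → ZFSet.{u}}
    (hE : ∀ i ∈ V_ θ, E i ⊆ V_ θ) :
    ∃ e : StrongnessEmbedding κ θ, e.IsGenerated ∧ ∀ i ∈ V_ θ, E i ∈ e.M := by
  obtain ⟨e, he, hA⟩ := hℓ.exists_isGenerated_mem hθ hcof hκ
    (A := ZFSet.sep (fun c => snd c ∈ E (fst c)) (V_ θ)) ZFSet.sep_subset
  refine ⟨e, he, fun i hi => ?_⟩
  have hsection := sep_mem e.j (fun (v : Fin 2 → ZFSet.{u}) z => ZFSet.pair (v 1) z ∈ v 0)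
    (V_ κ.ord) ![⟨_, hA⟩, ⟨i, e.vonNeumann_subset i hi⟩]
  convert hsection using 1
  ext z
  simp only [ZFSet.mem_sep, Matrix.cons_val_zero, Matrix.cons_val_one, fst_pair, snd_pair,
    pair_mem_vonNeumann_iff hθ]
  exact ⟨fun hz => ⟨he.isSeedSet.subset (hE i hi hz), ⟨hi, hE i hi hz⟩, hz⟩, fun h => h.2.2⟩

theorem exists_forall_mitchellOrder (hℓ : IsJointLaverSequence κ θ θ.cof.ord ℓ)
    (hθ : Order.IsSuccLimit θ) (hcof : θ.cof ≤ κ) (hκ : κ.ord < θ) {ι : Type (u + 1)}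
    (hι : #ι ≤ Cardinal.lift.{u + 1} (ℶ_ θ)) (F : ι → {E : ZFSet.{u} // IsExtender κ θ E}) :
    ∃ G, ∀ i, MitchellOrder κ θ (F i) G := by
  obtain ⟨e₀, -, -⟩ := hℓ.exists_isGenerated_mem hθ hcof hκ (ZFSet.empty_subset (V_ θ))
  rw [← e₀.card_vonNeumann hκ, ← ZFSet.cardinalMk_coe_sort] at hι
  obtain ⟨f⟩ := hι
  have hf : Function.Injective fun i => (f i : ZFSet.{u}) :=
    Subtype.val_injective.comp f.injective
  let E := Function.extend (fun i => (f i : ZFSet.{u})) (fun i => (F i).1) fun _ => ∅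
  have hE (i : ι) : E (f i) = (F i).1 := hf.extend_apply _ _ i
  have hEsub (x) (_ : x ∈ V_ θ) : E x ⊆ V_ θ := by
    by_cases hx : ∃ i, (f i : ZFSet.{u}) = x
    · obtain ⟨i, rfl⟩ := hx
      exact hE i ▸ (F i).2.subset_vonNeumann hθ hκ
    · rw [show E x = ∅ from Function.extend_apply' _ _ _ hx]
      exact ZFSet.empty_subset _
  obtain ⟨e, he, hEM⟩ := hℓ.exists_isGenerated_forall_mem hθ hcof hκ hEsub
  exact ⟨⟨derivedExtender e, e, he.isSeedSet.subset, rfl⟩, fun i =>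
    (mitchellOrder_iff_mem he rfl).2 (hE i ▸ hEM _ (f i).2)⟩

theorem exists_le_rank (hℓ : IsJointLaverSequence κ θ θ.cof.ord ℓ) (hθ : Order.IsSuccLimit θ)
    (hcof : θ.cof ≤ κ) (hκ : κ.ord < θ) [IsWellFounded _ (MitchellOrder κ θ)] (α : Ordinal.{u})
    (hα : α < (Order.succ (ℶ_ θ)).ord) : ∃ F : {E : ZFSet.{u} // IsExtender κ θ E},
      Ordinal.lift.{u + 1} α ≤ IsWellFounded.rank (MitchellOrder κ θ) F := by
  induction α using WellFoundedLT.induction with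
  | ind α ih =>
    choose F hF using fun β : Set.Iio α => ih β β.2 (β.2.trans hα)
    have hcard : #(Set.Iio α) ≤ Cardinal.lift.{u + 1} (ℶ_ θ) := by
      rw [Cardinal.mk_Iio_ordinal, Cardinal.lift_le]
      exact Order.lt_succ_iff.1 (Cardinal.lt_ord.1 hα)
    obtain ⟨G, hG⟩ := hℓ.exists_forall_mitchellOrder hθ hcof hκ hcard F
    refine ⟨G, le_of_forall_lt fun β' hβ' => ?_⟩
    obtain ⟨β, hβ, rfl⟩ := Ordinal.lt_lift_iff.1 hβ'
    exact (hF ⟨β, hβ⟩).trans_lt (IsWellFounded.rank_lt_of_rel (hG ⟨β, hβ⟩))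

theorem le_mitchellRank (hℓ : IsJointLaverSequence κ θ θ.cof.ord ℓ) (hθ : Order.IsSuccLimit θ)
    (hcof : θ.cof ≤ κ) (hκ : κ.ord < θ) [IsWellFounded _ (MitchellOrder κ θ)] :
    Ordinal.lift.{u + 1} (Order.succ (ℶ_ θ)).ord ≤ mitchellRank κ θ := by
  refine le_of_forall_lt fun α' hα' => ?_
  obtain ⟨α, hα, rfl⟩ := Ordinal.lt_lift_iff.1 hα'
  obtain ⟨F, hF⟩ := hℓ.exists_le_rank hθ hcof hκ α hα
  exact (Order.lt_succ_of_le hF).trans_le (Ordinal.le_iSup (fun E =>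
    Order.succ (IsWellFounded.rank (MitchellOrder κ θ) E)) F)

end IsJointLaverSequence

end JointLaver

end StrongLaver

end

theorem mainTheorem6 (κ : Cardinal.{u}) (θ : Ordinal.{u})
    (hstrong : StrongLaver.IsStrong κ θ)
    (hlimit : Order.IsSuccLimit θ)
    (hcof : θ.cof ≤ κ)
    (hlt : κ.ord < θ)
    (hjoint : ∃ ℓ : Ordinal.{u} → ZFSet.{u},
      StrongLaver.IsJointLaverSequence κ θ θ.cof.ord ℓ) :
    StrongLaver.HasMaximalMitchellRank κ θ := by
  obtain ⟨ℓ, hℓ⟩ := hjoint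
  have hwf := StrongLaver.isWellFounded_mitchellOrder hlimit hlt
  exact ⟨hwf, (StrongLaver.mitchellRank_le hlimit hlt).antisymm
    (hℓ.le_mitchellRank hlimit hcof hlt)⟩
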